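/- Rings are associative with identity, not necessarily commutative; modules are right modules unless stated otherwise. A module $E$ is \emph{FP-injective} if $\mathrm{Ext}^1_R(F,E)=0$ for every finitely presented $F$. The \emph{FP-injective dimension} of a module $N$ is the least integer $n\ge 0$ such that $\mathrm{Ext}^{n+1}_R(F,N)=0$ for every finitely presented $F$, and $\infty$ if there is no such $n$. A ring $R$ is a \emph{Ding--Chen ring} if it is left and right coherent and, for some integer $n\ge 0$, the FP-injective dimensions of $R$ as a left and as a right module over itself are both equal to $n$. A module $N$ is \emph{Ding injective} if there is an exact sequence of injective modules $$\cdots\to I_1\to I_0\to I^0\to I^1\to\cdots$$ with $N\cong\ker(I^0\to I^1)$ which remains exact after applying $\mathrm{Hom}_R(E,-)$ for every FP-injective module $E$. \textbf{Corollary.} Let $R$ be a Ding--Chen ring. An $R$-module has finite FP-injective dimension if and only if it has finite flat dimension; call such modules \emph{trivial}, and let $\mathcal W$ be the class of trivial modules. Then a module $N$ is Ding injective if and only if $\mathrm{Ext}^1_R(W,N)=0$ for every $W\in\mathcal W$. In other words, the class of Ding injective modules is exactly the right orthogonal $\mathcal W^{\perp}$ of the class of trivial modules. -/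

import Mathlib

open CategoryTheory Opposite
open scoped TensorProduct

universe u

noncomputable section

/- Conventions. Rings are associative with identity and need not be commutative. A *left* module
over `R` is an object of `ModuleCat R`; a *right* module over `R` is a left module over the opposite
ring, that is, an object of `ModuleCat Rᵐᵒᵖ`, with `m · r = MulOpposite.op r • m`. Definitions made
for left modules over an arbitrary ring `A` apply to right `R`-modules with `A = Rᵐᵒᵖ`. -/

section FPInjective

variable {A : Type u} [Ring A]

/-- `E` is FP-injective: `Ext¹(F, E) = 0` for all finitely presented modules `F`. -/
def IsFPInjective (E : ModuleCat.{u} A) : Prop :=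
  ∀ F : ModuleCat.{u} A, Module.FinitePresentation A F → Subsingleton (Abelian.Ext F E 1)

/-- The FP-injective dimension of `N`: the least `n ≥ 0` with `Ext^{n+1}(F, N) = 0` for all finitely
presented modules `F`, and `∞` if there is no such `n`. -/
def fpInjectiveDimension (N : ModuleCat.{u} A) : ℕ∞ :=
  ⨅ (n : ℕ) (_ : ∀ F : ModuleCat.{u} A, Module.FinitePresentation A F →
    Subsingleton (Abelian.Ext F N (n + 1))), (n : ℕ∞)

/-- `N` is Ding injective: there is an exact complex `⋯ → I⁻¹ → I⁰ → I¹ → ⋯` of injective modules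
with `N ≅ ker (I⁰ → I¹)` which remains exact after applying `Hom(E, -)` for any FP-injective
module `E`. -/
def IsDingInjective (N : ModuleCat.{u} A) : Prop :=
  ∃ I : CochainComplex (ModuleCat.{u} A) ℤ,
    (∀ i : ℤ, Injective (I.X i)) ∧
    I.Acyclic ∧
    Nonempty (N ≅ Limits.kernel (I.d 0 1)) ∧
    ∀ E : ModuleCat.{u} A, IsFPInjective E →
      (((preadditiveCoyoneda.obj (op E)).mapHomologicalComplex (ComplexShape.up ℤ)).obj I).Acyclic

end FPInjective

section DingChen

variable (R : Type u) [Ring R]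

/-- Left coherent: every finitely generated left ideal is finitely presented. -/
def IsLeftCoherentRing : Prop :=
  ∀ I : Submodule R R, I.FG → Module.FinitePresentation R I

/-- Right coherent: every finitely generated right ideal is finitely presented. -/
def IsRightCoherentRing : Prop :=
  ∀ I : Submodule Rᵐᵒᵖ R, I.FG → Module.FinitePresentation Rᵐᵒᵖ I

/-- An `n`-FC ring: left and right coherent, and `R` has FP-injective dimension exactly `n` both as
a left and as a right module over itself. -/
structure IsFCRing (n : ℕ) : Prop where
  left_coherent : IsLeftCoherentRing R
  right_coherent : IsRightCoherentRing R
  left_dim : fpInjectiveDimension (ModuleCat.of R R) = n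
  right_dim : fpInjectiveDimension (ModuleCat.of Rᵐᵒᵖ R) = n

/-- A Ding-Chen ring is an `n`-FC ring for some natural number `n`. -/
def IsDingChenRing : Prop := ∃ n : ℕ, IsFCRing R n

end DingChen

section Flat

variable {R : Type u} [Ring R]

section

variable (M : Type u) [AddCommGroup M]

/-- The homomorphism `M ⊗_ℤ L → M ⊗_ℤ L'`, `m ⊗ x ↦ m ⊗ f x`. -/
def intTensorMap {L L' : Type u} [AddCommGroup L] [Module R L]
    [AddCommGroup L'] [Module R L'] (f : L →ₗ[R] L') : M ⊗[ℤ] L →+ M ⊗[ℤ] L' :=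
  (f.toAddMonoidHom.toIntLinearMap.lTensor M).toAddMonoidHom

lemma intTensorMap_tmul {L L' : Type u} [AddCommGroup L] [Module R L]
    [AddCommGroup L'] [Module R L'] (f : L →ₗ[R] L') (m : M) (x : L) :
    intTensorMap M f (m ⊗ₜ[ℤ] x) = m ⊗ₜ[ℤ] f x := rfl

variable (R) [Module Rᵐᵒᵖ M]

/-- The subgroup of `M ⊗_ℤ L` generated by the elements `(m · r) ⊗ x - m ⊗ (r x)`. -/
def balancedRelations (L : Type u) [AddCommGroup L] [Module R L] : AddSubgroup (M ⊗[ℤ] L) :=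
  AddSubgroup.closure {t | ∃ (m : M) (r : R) (x : L),
    t = (MulOpposite.op r • m) ⊗ₜ[ℤ] x - m ⊗ₜ[ℤ] (r • x)}

/-- The tensor product `M ⊗_R L` of a right `R`-module `M` and a left `R`-module `L`,
as an abelian group. -/
abbrev BalancedTensor (L : Type u) [AddCommGroup L] [Module R L] : Type u :=
  (M ⊗[ℤ] L) ⧸ balancedRelations R M L

variable {R}

lemma balancedRelations_le_comap {L L' : Type u} [AddCommGroup L] [Module R L]
    [AddCommGroup L'] [Module R L'] (f : L →ₗ[R] L') :
    balancedRelations R M L ≤ (balancedRelations R M L').comap (intTensorMap M f) := by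
  refine (AddSubgroup.closure_le _).2 ?_
  rintro _ ⟨m, r, x, rfl⟩
  refine AddSubgroup.subset_closure ⟨m, r, f x, ?_⟩
  rw [map_sub, intTensorMap_tmul, intTensorMap_tmul, map_smul]

/-- The homomorphism `M ⊗_R L → M ⊗_R L'`, `m ⊗ x ↦ m ⊗ f x`. -/
def BalancedTensor.map {L L' : Type u} [AddCommGroup L] [Module R L]
    [AddCommGroup L'] [Module R L'] (f : L →ₗ[R] L') :
    BalancedTensor R M L →+ BalancedTensor R M L' :=
  QuotientAddGroup.map _ _ (intTensorMap M f) (balancedRelations_le_comap M f)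

end

/-- The right `R`-module `M` is flat: `M ⊗_R -` preserves injectivity of homomorphisms of left
`R`-modules. -/
def IsFlatRight (M : ModuleCat.{u} Rᵐᵒᵖ) : Prop :=
  ∀ (L L' : ModuleCat.{u} R) (f : L →ₗ[R] L'), Function.Injective f →
    Function.Injective (BalancedTensor.map (R := R) M f)

/-- `M` has a flat resolution `0 → F_n → ⋯ → F_1 → F_0 → M → 0` of length `n`. (Such a resolution is
a short exact sequence `0 → K → F_0 → M → 0` with `F_0` flat, spliced with a flat resolution
`0 → F_n → ⋯ → F_1 → K → 0` of length `n - 1`.) -/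
def HasFlatResolution : ℕ → ModuleCat.{u} Rᵐᵒᵖ → Prop
  | 0, M => IsFlatRight M
  | n + 1, M => ∃ S : ShortComplex (ModuleCat.{u} Rᵐᵒᵖ), S.ShortExact ∧ Nonempty (S.X₃ ≅ M) ∧
      IsFlatRight S.X₂ ∧ HasFlatResolution n S.X₁

/-- The flat dimension of the right `R`-module `M`: the least length of a flat resolution, and `∞` if
there is no finite one. -/
def flatDimension (M : ModuleCat.{u} Rᵐᵒᵖ) : ℕ∞ :=
  ⨅ (n : ℕ) (_ : HasFlatResolution n M), (n : ℕ∞)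

end Flat

end

/-! Write `S` for `Rᵐᵒᵖ`, so that right `R`-modules are left `S`-modules. By coherence finitely
presented modules have resolutions by finite free modules, and Ext and Tor against them become
statements about matrix equations in a module: `SyzExact` (vanishing of Ext) and `TorExact`
(vanishing of Tor).

Triviality. The dual of an exact sequence of finite free modules is exact from position `n` on, on
either side, because `R` has FP-injective dimension `n` on both sides (`rowDual_of_syzExact`,
`RowDual.op`). A column sequence past position `n` is thus a row sequence, and by coherence each of
its matrices is an arbitrarily high row syzygy. Hence any finite FP-injective dimension forces flat
dimension at most `n` (`SyzExact.torExact`); dually a flat module has FP-injective dimension at most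
`n` (`TorExact.syzExact`), and this passes along finite flat resolutions. So the trivial modules are
exactly those satisfying `SyzExact S n`.

Ding injective implies orthogonal (`IsDingInjective.subsingleton_ext`). All cycles of the given
complex are orthogonal to FP-injective modules. Embedding a trivial module in an injective one
lowers its FP-injective dimension, and the dimension shift is compensated by moving to the next
cycle.

Orthogonal implies Ding injective (`IsSyzOrthogonal.isDingInjective`). On the right, cosyzygies stay
orthogonal since the trivial modules are closed under syzygies. On the left, `N` needs a surjection
from a trivial module with orthogonal kernel (`exists_syzExact_cover`). The source is then both
trivial and orthogonal, hence a summand of an injective module. Splicing gives the complex.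

The cover comes from the small object argument. Pure submodules of bounded size reduce orthogonality
to a set of tests (`ExtendsSmall.extend`). That the covering module is trivial is itself a lifting
property, against maps between powers of the character module of `S` (`exists_lift_transpose`,
`exactAt_of_lift`). -/

/-! ### Matrix form of Ext and Tor vanishing; dimension shifting and duality -/

section MatrixExact

open Matrix

variable {S : Type*} [Ring S]

/-- The action of a matrix with entries in `S` on columns with entries in an `S`-module. -/
def colAct {m n : Type*} [Fintype n] (E : Type*) [AddCommGroup E] [Module S E]
    (A : Matrix m n S) : (n → E) →+ (m → E) where
  toFun e i := ∑ j, A i j • e j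
  map_zero' := by ext; simp
  map_add' e f := by ext; simp [Finset.sum_add_distrib]

lemma colAct_apply {m n : Type*} [Fintype n] {E : Type*} [AddCommGroup E] [Module S E]
    (A : Matrix m n S) (e : n → E) (i : m) : colAct E A e i = ∑ j, A i j • e j := rfl

lemma colAct_mul {l m n : Type*} [Fintype n] [Fintype m] {E : Type*} [AddCommGroup E] [Module S E]
    (B : Matrix l m S) (A : Matrix m n S) (e : n → E) :
    colAct E B (colAct E A e) = colAct E (B * A) e := by
  ext i
  simp only [colAct_apply, Matrix.mul_apply, Finset.smul_sum, Finset.sum_smul, mul_smul]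
  rw [Finset.sum_comm]

lemma colAct_zero {m n : Type*} [Fintype n] {E : Type*} [AddCommGroup E] [Module S E]
    (e : n → E) : colAct E (0 : Matrix m n S) e = 0 := by
  ext i
  simp [colAct_apply]

lemma colAct_self {m n : Type*} [Fintype n] (A : Matrix m n S) (e : n → S) :
    colAct S A e = A *ᵥ e := by
  ext i
  simp [colAct_apply, Matrix.mulVec, dotProduct]

lemma colAct_map {m n : Type*} [Fintype n] {E E' : Type*} [AddCommGroup E] [Module S E]
    [AddCommGroup E'] [Module S E'] (f : E →ₗ[S] E') (A : Matrix m n S) (e : n → E) :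
    colAct E' A (f ∘ e) = f ∘ colAct E A e := by
  ext i
  simp [colAct_apply]

variable {p q r : ℕ}

/-- The sequence of row spaces given by right multiplication by `B` and then `A` is exact. -/
def RowExact (B : Matrix (Fin r) (Fin q) S) (A : Matrix (Fin q) (Fin p) S) : Prop :=
  ∀ x : Fin q → S, x ᵥ* A = 0 ↔ ∃ y, y ᵥ* B = x

/-- The sequence of column spaces given by left multiplication by `A` and then `B` is exact. -/
def ColExact (B : Matrix (Fin r) (Fin q) S) (A : Matrix (Fin q) (Fin p) S) : Prop :=
  ∀ x : Fin q → S, B *ᵥ x = 0 ↔ ∃ y, A *ᵥ y = x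

/-- Every column with entries in `E` killed by `B` is a multiple of `A`. -/
def ExactAt (B : Matrix (Fin r) (Fin q) S) (A : Matrix (Fin q) (Fin p) S)
    (E : Type*) [AddCommGroup E] [Module S E] : Prop :=
  ∀ e : Fin q → E, colAct E B e = 0 → ∃ f, colAct E A f = e

lemma RowExact.mul_eq_zero {B : Matrix (Fin r) (Fin q) S} {A : Matrix (Fin q) (Fin p) S}
    (h : RowExact B A) : B * A = 0 := by
  ext i j
  have := (h (Pi.single i 1 ᵥ* B)).2 ⟨_, rfl⟩
  rw [Matrix.vecMul_vecMul] at this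
  simpa using congrFun this j

lemma ColExact.mul_eq_zero {B : Matrix (Fin r) (Fin q) S} {A : Matrix (Fin q) (Fin p) S}
    (h : ColExact B A) : B * A = 0 := by
  ext i j
  have := (h (A *ᵥ Pi.single j 1)).2 ⟨_, rfl⟩
  rw [Matrix.mulVec_mulVec] at this
  simpa using congrFun this i

/-- `A` is the `k`-th matrix, counted from `0`, of an exact sequence of row spaces. -/
def RowSyz : ℕ → ∀ {q p : ℕ}, Matrix (Fin q) (Fin p) S → Prop
  | 0, _, _, _ => True
  | k + 1, _, q, B => ∃ (p : ℕ) (A : Matrix (Fin q) (Fin p) S), RowSyz k A ∧ RowExact B A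

/-- `B` is the `k`-th matrix, counted from `0`, of an exact sequence of column spaces. -/
def ColSyz : ℕ → ∀ {q p : ℕ}, Matrix (Fin q) (Fin p) S → Prop
  | 0, _, _, _ => True
  | k + 1, q, _, A => ∃ (r : ℕ) (B : Matrix (Fin r) (Fin q) S), ColSyz k B ∧ ColExact B A

lemma RowSyz.of_succ {k : ℕ} : ∀ {q p : ℕ} {A : Matrix (Fin q) (Fin p) S},
    RowSyz (k + 1) A → RowSyz k A := by
  induction k with
  | zero => intros; trivial
  | succ k ih => rintro q p B ⟨_, A, hA, h⟩; exact ⟨_, A, ih hA, h⟩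

lemma ColSyz.of_succ {k : ℕ} : ∀ {q p : ℕ} {A : Matrix (Fin q) (Fin p) S},
    ColSyz (k + 1) A → ColSyz k A := by
  induction k with
  | zero => intros; trivial
  | succ k ih => rintro q p B ⟨_, A, hA, h⟩; exact ⟨_, A, ih hA, h⟩

variable (S) in
/-- Row kernels of matrices over `S` are finitely generated. -/
def RowCoherent : Prop :=
  ∀ ⦃q p : ℕ⦄ (A : Matrix (Fin q) (Fin p) S), ∃ (r : ℕ) (B : Matrix (Fin r) (Fin q) S), RowExact B A

variable (S) in
/-- Column kernels of matrices over `S` are finitely generated. -/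
def ColCoherent : Prop :=
  ∀ ⦃r q : ℕ⦄ (B : Matrix (Fin r) (Fin q) S), ∃ (p : ℕ) (A : Matrix (Fin q) (Fin p) S), ColExact B A

variable (S) in
/-- Exact sequences of row spaces have exact duals from position `n` on. -/
def RowDual (n : ℕ) : Prop :=
  ∀ ⦃r q p : ℕ⦄ (B : Matrix (Fin r) (Fin q) S) (A : Matrix (Fin q) (Fin p) S),
    RowSyz n A → RowExact B A → ColExact B A

variable (S) in
/-- Exact sequences of column spaces have exact duals from position `n` on. -/
def ColDual (n : ℕ) : Prop :=
  ∀ ⦃r q p : ℕ⦄ (B : Matrix (Fin r) (Fin q) S) (A : Matrix (Fin q) (Fin p) S),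
    ColSyz n B → ColExact B A → RowExact B A

variable (S) in
/-- The elementary form of `Ext^{k+1}(F, E) = 0` for all finitely presented `F`. -/
def SyzExact (k : ℕ) (E : Type*) [AddCommGroup E] [Module S E] : Prop :=
  ∀ ⦃r q p : ℕ⦄ (B : Matrix (Fin r) (Fin q) S) (A : Matrix (Fin q) (Fin p) S),
    RowSyz k A → RowExact B A → ExactAt B A E

variable (S) in
/-- The elementary form of `Tor_{k+1}(E, L) = 0` for all finitely presented `L`. -/
def TorExact (k : ℕ) (E : Type*) [AddCommGroup E] [Module S E] : Prop :=
  ∀ ⦃r q p : ℕ⦄ (B : Matrix (Fin r) (Fin q) S) (A : Matrix (Fin q) (Fin p) S),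
    ColSyz k B → ColExact B A → ExactAt B A E

section

variable {E : Type*} [AddCommGroup E] [Module S E]

lemma SyzExact.succ {k : ℕ} (h : SyzExact S k E) : SyzExact S (k + 1) E :=
  fun _ _ _ B A hA hBA => h B A hA.of_succ hBA

lemma SyzExact.mono {k l : ℕ} (h : SyzExact S k E) (hkl : k ≤ l) : SyzExact S l E := by
  induction hkl with
  | refl => exact h
  | step _ ih => exact ih.succ

/-- Continue the column sequence to the left by coherence for `m` steps. Past position `n` its dual
is row exact, and in the dual direction the added matrices precede `A`. The freedom in `m` is what
bounds all finite dimensions by `n`. -/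
lemma ColSyz.rowSyz {n : ℕ} (hC : ColCoherent S) (hD : ColDual S n) (m : ℕ) :
    ∀ {q p : ℕ} (A : Matrix (Fin q) (Fin p) S), ColSyz n A → RowSyz m A := by
  induction m with
  | zero => intros; trivial
  | succ m ih =>
    intro q p A hA
    obtain ⟨_, A', h⟩ := hC A
    exact ⟨_, A', ih A' (ColSyz.of_succ ⟨_, A, hA, h⟩), hD A A' hA h⟩

lemma SyzExact.torExact {n m : ℕ} (hC : ColCoherent S) (hD : ColDual S n) (h : SyzExact S m E) :
    TorExact S n E := fun _ _ _ B A hB hBA =>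
  h B A (ColSyz.rowSyz hC hD m A (ColSyz.of_succ ⟨_, B, hB, hBA⟩)) (hD B A hB hBA)

lemma TorExact.syzExact {n : ℕ} (hD : RowDual S n) (h : TorExact S 0 E) : SyzExact S n E :=
  fun _ _ _ B A hA hBA => h B A trivial (hD B A hA hBA)

end

section

variable {X Y Z : Type*} [AddCommGroup X] [Module S X] [AddCommGroup Y] [Module S Y]
  [AddCommGroup Z] [Module S Z] {f : X →ₗ[S] Y} {g : Y →ₗ[S] Z}

lemma exists_comp_eq_of_comp_eq_zero (hfg : Function.Exact f g) {ι : Type*} (e : ι → Y)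
    (he : g ∘ e = 0) : ∃ x : ι → X, f ∘ x = e := by
  choose x hx using fun i => (hfg (e i)).1 (congrFun he i)
  exact ⟨x, funext hx⟩

/-- This and the next two lemmas are pieces of the long exact sequences of Ext and Tor, done by
diagram chase. Here the obstruction to lifting a solution lies in `X` and is killed by the next
matrix `C`, which coherence supplies. -/
lemma SyzExact.quotient {k : ℕ} (hR : RowCoherent S) (hf : Function.Injective f)
    (hfg : Function.Exact f g) (hg : Function.Surjective g)
    (hX : SyzExact S (k + 1) X) (hY : SyzExact S k Y) : SyzExact S k Z := by
  intro r q p B A hA hBA e he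
  obtain ⟨_, C, hCB⟩ := hR B
  obtain ⟨e', rfl⟩ : ∃ e', g ∘ e' = e := ⟨fun i => (hg (e i)).choose,
    funext fun i => (hg (e i)).choose_spec⟩
  rw [colAct_map] at he
  obtain ⟨x, hx⟩ := exists_comp_eq_of_comp_eq_zero hfg _ he
  obtain ⟨y, rfl⟩ := hX C B ⟨_, A, hA, hBA⟩ hCB x (by
    have : f ∘ colAct X C x = 0 := by
      rw [← colAct_map, hx, colAct_mul, hCB.mul_eq_zero, colAct_zero]
    ext i
    exact hf (by simpa using congrFun this i))
  obtain ⟨z, hz⟩ := hY B A hA hBA (e' - f ∘ y) (by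
    rw [map_sub, colAct_map, hx, sub_self])
  refine ⟨g ∘ z, ?_⟩
  rw [colAct_map, hz]
  ext i
  simp [hfg.apply_apply_eq_zero]

lemma SyzExact.kernel_succ {k : ℕ} (hf : Function.Injective f) (hfg : Function.Exact f g)
    (hg : Function.Surjective g) (hY : SyzExact S k Y) (hZ : SyzExact S k Z) :
    SyzExact S (k + 1) X := by
  rintro r q p B A ⟨_, D, hD, hAD⟩ hBA e he
  obtain ⟨y, hy⟩ := hY.succ B A ⟨_, D, hD, hAD⟩ hBA (f ∘ e) (by rw [colAct_map, he]; ext; simp)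
  obtain ⟨z, hz⟩ := hZ A D hD hAD (g ∘ y) (by
    rw [colAct_map, hy]
    ext i
    simp [hfg.apply_apply_eq_zero])
  obtain ⟨z', rfl⟩ : ∃ e', g ∘ e' = z := ⟨fun i => (hg (z i)).choose,
    funext fun i => (hg (z i)).choose_spec⟩
  obtain ⟨x, hx⟩ := exists_comp_eq_of_comp_eq_zero hfg (y - colAct Y D z') (by
    ext i
    simpa [sub_eq_zero] using (congrFun (hz.symm.trans (colAct_map g D z')) i))
  refine ⟨x, ?_⟩
  have : f ∘ colAct X A x = f ∘ e := by
    rw [← colAct_map, hx, map_sub, hy, colAct_mul, hAD.mul_eq_zero, colAct_zero, sub_zero]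
  ext i
  exact hf (congrFun this i)

lemma TorExact.syzygy {k : ℕ} (hC : ColCoherent S) (hf : Function.Injective f)
    (hfg : Function.Exact f g) (hg : Function.Surjective g)
    (hY : TorExact S 0 Y) (hZ : TorExact S (k + 1) Z) : TorExact S k X := by
  intro r q p B A hB hBA e he
  obtain ⟨y, hy⟩ := hY B A trivial hBA (f ∘ e) (by rw [colAct_map, he]; ext; simp)
  obtain ⟨_, D, hAD⟩ := hC A
  obtain ⟨z, hz⟩ := hZ A D ⟨_, B, hB, hBA⟩ hAD (g ∘ y) (by
    rw [colAct_map, hy]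
    ext i
    simp [hfg.apply_apply_eq_zero])
  obtain ⟨z', rfl⟩ : ∃ e', g ∘ e' = z := ⟨fun i => (hg (z i)).choose,
    funext fun i => (hg (z i)).choose_spec⟩
  obtain ⟨x, hx⟩ := exists_comp_eq_of_comp_eq_zero hfg (y - colAct Y D z') (by
    ext i
    simpa [sub_eq_zero] using (congrFun (hz.symm.trans (colAct_map g D z')) i))
  refine ⟨x, ?_⟩
  have : f ∘ colAct X A x = f ∘ e := by
    rw [← colAct_map, hx, map_sub, hy, colAct_mul, hAD.mul_eq_zero, colAct_zero, sub_zero]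
  ext i
  exact hf (congrFun this i)

end

section

variable {E : Type*} [AddCommGroup E] [Module S E]

lemma ExactAt.of_linearEquiv {B : Matrix (Fin r) (Fin q) S} {A : Matrix (Fin q) (Fin p) S}
    {E' : Type*} [AddCommGroup E'] [Module S E'] (φ : E ≃ₗ[S] E') (h : ExactAt B A E) :
    ExactAt B A E' := by
  intro e he
  obtain ⟨f, hf⟩ := h (φ.symm ∘ e) (by
    have := colAct_map φ.symm.toLinearMap B e
    rw [he] at this
    ext i
    simpa using congrFun this i)
  refine ⟨φ ∘ f, ?_⟩
  have := colAct_map φ.toLinearMap A f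
  rw [hf] at this
  ext i
  simpa using congrFun this i

lemma ExactAt.finsupp {B : Matrix (Fin r) (Fin q) S} {A : Matrix (Fin q) (Fin p) S}
    (h : ExactAt B A E) (ι : Type*) : ExactAt B A (ι →₀ E) := by
  classical
  intro e he
  -- Choosing the zero solution wherever the right hand side vanishes keeps the assembled solution
  -- finitely supported.
  have key : ∀ a : ι, ∃ f : Fin p → E, colAct E A f = (fun i => e i a) ∧
      ((∀ i, e i a = 0) → f = 0) := by
    intro a
    by_cases ha : ∀ i, e i a = 0
    · exact ⟨0, by ext i; simp [ha], fun _ => rfl⟩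
    · obtain ⟨f, hf⟩ := h (fun i => e i a) (by
        ext i
        simpa [colAct_apply, Finsupp.finsetSum_apply] using DFunLike.congr_fun (congrFun he i) a)
      exact ⟨f, hf, fun h => absurd h ha⟩
  choose f hf hf0 using key
  refine ⟨fun j => Finsupp.onFinset (Finset.univ.biUnion fun i => (e i).support)
    (fun a => f a j) fun a ha => ?_, ?_⟩
  · by_contra hc
    simp only [Finset.mem_biUnion, Finset.mem_univ, Finsupp.mem_support_iff, true_and,
      not_exists, not_not] at hc
    exact ha (by simp [hf0 a hc])
  · ext i a
    simpa [colAct_apply, Finsupp.finsetSum_apply] using congrFun (hf a) i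

lemma SyzExact.of_linearEquiv {k : ℕ} {E' : Type*} [AddCommGroup E'] [Module S E']
    (φ : E ≃ₗ[S] E') (h : SyzExact S k E) : SyzExact S k E' :=
  fun _ _ _ B A hA hBA => (h B A hA hBA).of_linearEquiv φ

variable (S) in
lemma torExact_zero_finsupp (ι : Type*) : TorExact S 0 (ι →₀ S) := by
  intro r q p B A _ hBA
  refine ExactAt.finsupp (fun e he => ?_) ι
  rw [colAct_self] at he
  obtain ⟨y, hy⟩ := (hBA e).1 he
  exact ⟨y, by rw [colAct_self, hy]⟩

lemma SyzExact.finsupp {k : ℕ} (h : SyzExact S k E) (ι : Type*) : SyzExact S k (ι →₀ E) :=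
  fun _ _ _ B A hA hBA => (h B A hA hBA).finsupp ι

end

end MatrixExact

/-! ### Pure submodules of bounded size -/

section Pure

/-- Formal expressions in one variable built from the module operations and from solutions of
systems of linear equations over `S`. -/
inductive PureTerm (S : Type u) : Type u
  | var : PureTerm S
  | zero : PureTerm S
  | add : PureTerm S → PureTerm S → PureTerm S
  | smul : S → PureTerm S → PureTerm S
  | sol {q p : ℕ} : Matrix (Fin q) (Fin p) S → (Fin q → PureTerm S) → Fin p → PureTerm S

instance (S : Type u) : Inhabited (PureTerm S) := ⟨.var⟩

variable {S : Type u} [Ring S] {W : Type*} [AddCommGroup W] [Module S W]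

open Classical in
/-- The value of a formal expression at an element of a module. -/
noncomputable def PureTerm.eval (x : W) : PureTerm S → W
  | .var => x
  | .zero => 0
  | .add s t => s.eval x + t.eval x
  | .smul a t => a • t.eval x
  | .sol A e i =>
      if h : ∃ f, colAct W A f = fun k => (e k).eval x then h.choose i else 0

/-- A submodule is pure if systems of linear equations with right hand sides in the submodule that
are solvable in the module are solvable in the submodule. -/
def Submodule.IsPureIn (X : Submodule S W) : Prop :=
  ∀ {q p : ℕ} (A : Matrix (Fin q) (Fin p) S) (e : Fin q → X),
    (∃ f, colAct W A f = X.subtype ∘ e) → ∃ f, colAct X A f = e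

-- The values at `x` of all formal expressions form such a submodule: if a system with right hand
-- sides in it is solvable in `W`, the `sol` expressions name a solution. The expressions depend
-- only on `S`, so one free module covers all these submodules, whatever `W` is.
variable (S) in
lemma exists_isPureIn (x : W) : ∃ X : Submodule S W, x ∈ X ∧ X.IsPureIn ∧
    ∃ π : (PureTerm S →₀ S) →ₗ[S] X, Function.Surjective π := by
  classical
  let X : Submodule S W :=
    { carrier := Set.range (PureTerm.eval (S := S) x)
      zero_mem' := ⟨.zero, by rw [PureTerm.eval]⟩
      add_mem' := by
        rintro _ _ ⟨s, rfl⟩ ⟨t, rfl⟩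
        exact ⟨.add s t, by rw [PureTerm.eval]⟩
      smul_mem' := by
        rintro a _ ⟨t, rfl⟩
        exact ⟨.smul a t, by rw [PureTerm.eval]⟩ }
  refine ⟨X, ⟨.var, by rw [PureTerm.eval]⟩, ?_,
    Finsupp.linearCombination S (fun t => (⟨t.eval x, t, rfl⟩ : X)), ?_⟩
  · rintro q p A e ⟨f, hf⟩
    choose t ht using fun k => (e k).2
    have h : ∃ f, colAct W A f = fun k => (t k).eval x := ⟨f, by rw [hf]; ext k; simp [ht]⟩
    refine ⟨fun i => ⟨(PureTerm.sol A t i).eval x, _, rfl⟩, ?_⟩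
    ext k
    have hv : ∀ i, (PureTerm.sol A t i).eval x = h.choose i := fun i => by
      rw [PureTerm.eval, dif_pos h]
    rw [← (congrFun h.choose_spec k).trans (ht k)]
    simp only [colAct_apply, hv, Submodule.coe_sum, Submodule.coe_smul]
  · rintro ⟨_, t, rfl⟩
    exact ⟨Finsupp.single t 1, by simp⟩

variable {p q r : ℕ} {B : Matrix (Fin r) (Fin q) S} {A : Matrix (Fin q) (Fin p) S}

lemma Submodule.IsPureIn.exactAt {X : Submodule S W} (hX : X.IsPureIn) (h : ExactAt B A W) :
    ExactAt B A X := by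
  intro e he
  exact hX A e (h _ (by rw [colAct_map, he]; ext; simp))

lemma Submodule.IsPureIn.exactAt_quotient {X : Submodule S W} (hX : X.IsPureIn)
    (h : ExactAt B A W) {Z : Type*} [AddCommGroup Z] [Module S Z] {g : W →ₗ[S] Z}
    (hg : Function.Surjective g) (hXg : LinearMap.ker g = X) : ExactAt B A Z := by
  intro e he
  obtain ⟨e', rfl⟩ : ∃ e', g ∘ e' = e := ⟨fun i => (hg (e i)).choose,
    funext fun i => (hg (e i)).choose_spec⟩
  rw [colAct_map] at he
  obtain ⟨x, hx⟩ : ∃ x : Fin r → X, X.subtype ∘ x = colAct W B e' :=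
    ⟨fun i => ⟨colAct W B e' i, hXg ▸ congrFun he i⟩, rfl⟩
  obtain ⟨y, rfl⟩ := hX B x ⟨e', hx.symm⟩
  obtain ⟨z, hz⟩ := h (e' - X.subtype ∘ y) (by rw [map_sub, colAct_map, hx, sub_self])
  refine ⟨g ∘ z, ?_⟩
  rw [colAct_map, hz]
  ext i
  have : g (y i) = 0 := by rw [← LinearMap.mem_ker, hXg]; exact (y i).2
  simp [this]

end Pure

/-! ### Orthogonality tested on a set of inclusions -/

section Extend

variable {S : Type u} [Ring S]

lemma exists_linearPMap {M P N : Type*} [AddCommGroup M] [Module S M] [AddCommGroup P] [Module S P]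
    [AddCommGroup N] [Module S N] (f : M →ₗ[S] P) (v : M →ₗ[S] N)
    (h : LinearMap.ker f ≤ LinearMap.ker v) :
    ∃ g : P →ₗ.[S] N, g.domain = LinearMap.range f ∧
      ∀ (m : M) (x : g.domain), (x : P) = f m → g x = v m := by
  refine ⟨⟨LinearMap.range f, (LinearMap.ker f).liftQ v h ∘ₗ f.quotKerEquivRange.symm⟩, rfl, ?_⟩
  intro m x hx
  obtain rfl : x = ⟨f m, m, rfl⟩ := Subtype.ext hx
  change (LinearMap.ker f).liftQ v h (f.quotKerEquivRange.symm ⟨f m, m, rfl⟩) = v m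
  rw [show (⟨f m, m, rfl⟩ : LinearMap.range f) = f.quotKerEquivRange (Submodule.Quotient.mk m) from
    rfl, LinearEquiv.symm_apply_apply]
  simp

variable (S) in
/-- Maps to `N` extend from the submodules of the free module on `PureTerm S` whose quotients
are `SyzExact`. -/
def ExtendsSmall (k : ℕ) (N : Type*) [AddCommGroup N] [Module S N] : Prop :=
  ∀ K : Submodule S (PureTerm S →₀ S), SyzExact S k ((PureTerm S →₀ S) ⧸ K) →
    ∀ φ : K →ₗ[S] N, ∃ ψ : (PureTerm S →₀ S) →ₗ[S] N, ψ ∘ₗ K.subtype = φ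

variable {k : ℕ} {P N : Type*} [AddCommGroup P] [Module S P] [AddCommGroup N] [Module S N]

/-- A finite system holds modulo the union as soon as it holds modulo one member of the directed
family, and can be solved there. -/
lemma syzExact_quotient_sSup {c : Set (Submodule S P)} (hne : c.Nonempty) (hc : DirectedOn (· ≤ ·) c)
    (h : ∀ Q ∈ c, SyzExact S k (P ⧸ Q)) : SyzExact S k (P ⧸ sSup c) := by
  intro r q p B A hA hBA e he
  have hne' : Nonempty c := hne.to_subtype
  have hs := Submodule.mkQ_surjective (sSup c)
  obtain ⟨e', rfl⟩ : ∃ e', (sSup c).mkQ ∘ e' = e := ⟨fun i => (hs (e i)).choose,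
    funext fun i => (hs (e i)).choose_spec⟩
  rw [colAct_map] at he
  have h1 : ∀ i, ∃ Q : c, colAct P B e' i ∈ (Q : Submodule S P) := fun i => by
    have : colAct P B e' i ∈ sSup c := by simpa using congrFun he i
    obtain ⟨Q, hQ, hm⟩ := (Submodule.mem_sSup_of_directed hne hc).1 this
    exact ⟨⟨Q, hQ⟩, hm⟩
  choose Q hQ using h1
  obtain ⟨Q₀, hQ₀⟩ := (directedOn_iff_directed.1 hc).finite_le Q
  have h2 : colAct (P ⧸ (Q₀ : Submodule S P)) B ((Q₀ : Submodule S P).mkQ ∘ e') = 0 := by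
    rw [colAct_map]
    ext i
    simpa using hQ₀ i (hQ i)
  obtain ⟨f, hf⟩ := h Q₀ Q₀.2 B A hA hBA _ h2
  have hs' := Submodule.mkQ_surjective (Q₀ : Submodule S P)
  obtain ⟨f', rfl⟩ : ∃ f', (Q₀ : Submodule S P).mkQ ∘ f' = f := ⟨fun i => (hs' (f i)).choose,
    funext fun i => (hs' (f i)).choose_spec⟩
  refine ⟨(sSup c).mkQ ∘ f', ?_⟩
  rw [colAct_map] at hf ⊢
  ext i
  have h3 := congrFun hf i
  simp only [Function.comp_apply, Submodule.mkQ_apply, Submodule.Quotient.eq] at h3 ⊢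
  exact le_sSup Q₀.2 h3

/-- The successor step of the Zorn argument. Enlarge the domain by the preimage of a small pure
submodule `X` of the quotient. Purity makes both `X` and the new quotient `SyzExact`: the first
allows the map to be extended, the second lets the process go on. -/
lemma ExtendsSmall.exists_lt (hN : ExtendsSmall S k N) (g : P →ₗ.[S] N)
    (hg : SyzExact S k (P ⧸ g.domain)) (hne : g.domain ≠ ⊤) :
    ∃ g' : P →ₗ.[S] N, g < g' ∧ SyzExact S k (P ⧸ g'.domain) := by
  obtain ⟨x, hx⟩ : ∃ x, x ∉ g.domain := by
    by_contra! h
    exact hne (eq_top_iff.2 fun x _ => h x)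
  obtain ⟨X, hxX, hX, π, hπ⟩ := exists_isPureIn S (Submodule.Quotient.mk x : P ⧸ g.domain)
  obtain ⟨l, hl⟩ := Module.projective_lifting_property g.domain.mkQ (X.subtype ∘ₗ π)
    (Submodule.mkQ_surjective _)
  have hl' : ∀ f, (Submodule.Quotient.mk (l f) : P ⧸ g.domain) = π f := fun f =>
    LinearMap.congr_fun hl f
  have hlK : ∀ f, l f ∈ g.domain ↔ π f = 0 := fun f => by
    rw [← Submodule.Quotient.mk_eq_zero, hl', Submodule.coe_eq_zero]
  have hK : SyzExact S k ((PureTerm S →₀ S) ⧸ LinearMap.ker π) :=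
    SyzExact.of_linearEquiv (π.quotKerEquivOfSurjective hπ).symm
      (fun _ _ _ B A hA hBA => hX.exactAt (hg B A hA hBA))
  obtain ⟨θ, hθ⟩ := hN _ hK
    (g.toFun ∘ₗ (l ∘ₗ (LinearMap.ker π).subtype).codRestrict g.domain
      (fun f => (hlK f).2 f.2))
  have hθ' : ∀ f (hf : l f ∈ g.domain), θ f = g ⟨l f, hf⟩ := fun f hf =>
    LinearMap.congr_fun hθ ⟨f, (hlK f).1 hf⟩
  -- The maps `g` and `θ` glue on the sum of `g.domain` and the range of `l`: whenever `l f` lies in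
  -- `g.domain`, `θ f` was arranged to be the value of `g` there.
  obtain ⟨g', hdom, hg'⟩ := exists_linearPMap (g.domain.subtype.coprod l) (g.toFun.coprod θ) (by
    rintro ⟨y, f⟩ hy
    simp only [LinearMap.mem_ker, LinearMap.coprod_apply, Submodule.subtype_apply] at hy ⊢
    have h1 : l f = ((-y : g.domain) : P) := by
      rw [Submodule.coe_neg]
      exact (neg_eq_of_add_eq_zero_right hy).symm
    rw [hθ' f (h1 ▸ (-y).2)]
    have h2 : (⟨l f, h1 ▸ (-y).2⟩ : g.domain) = -y := Subtype.ext h1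
    rw [h2, LinearPMap.map_neg]
    exact add_neg_cancel _)
  have hle : g ≤ g' := by
    refine ⟨?_, ?_⟩
    · intro y hy
      rw [hdom]
      exact ⟨(⟨y, hy⟩, 0), by simp⟩
    · intro y z hyz
      rw [hg' (y, 0) z (by simp [hyz])]
      simp
  have hxg' : x ∈ g'.domain := by
    obtain ⟨f, hf⟩ := hπ ⟨_, hxX⟩
    have h1 : x - l f ∈ g.domain := by
      rw [← Submodule.Quotient.eq, hl', hf]
    rw [hdom]
    exact ⟨(⟨_, h1⟩, f), by simp⟩
  refine ⟨g', lt_of_le_of_ne hle (fun h => hx (h ▸ hxg')), fun _ _ _ B A hA hBA => ?_⟩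
  -- The new quotient is the old one modulo `X`.
  refine hX.exactAt_quotient (hg B A hA hBA) (Submodule.factor_surjective hle.1) ?_
  ext z
  obtain ⟨y, rfl⟩ := Submodule.mkQ_surjective _ z
  change (Submodule.Quotient.mk y : P ⧸ g'.domain) = 0 ↔ Submodule.Quotient.mk y ∈ X
  rw [Submodule.Quotient.mk_eq_zero]
  constructor
  · intro hy
    rw [hdom] at hy
    obtain ⟨⟨d, f⟩, rfl⟩ := hy
    simpa [hl'] using X.add_mem (x := Submodule.Quotient.mk (d : P))
      ((Submodule.Quotient.mk_eq_zero _).2 d.2 ▸ X.zero_mem) (π f).2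
  · intro hy
    obtain ⟨f, hf⟩ := hπ ⟨_, hy⟩
    have h1 : y - l f ∈ g.domain := by
      rw [← Submodule.Quotient.eq, hl', hf]
    rw [hdom]
    exact ⟨(⟨_, h1⟩, f), by simp⟩

lemma ExtendsSmall.extend (hN : ExtendsSmall S k N) (K : Submodule S P)
    (hK : SyzExact S k (P ⧸ K)) (φ : K →ₗ[S] N) : ∃ ψ : P →ₗ[S] N, ψ ∘ₗ K.subtype = φ := by
  let g₀ : P →ₗ.[S] N := ⟨K, φ⟩
  obtain ⟨g, hle, hmax⟩ := zorn_le_nonempty₀ {g : P →ₗ.[S] N | SyzExact S k (P ⧸ g.domain)}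
    (fun c hc hchain g hg => by
      have hd : DirectedOn (· ≤ ·) c := hchain.directedOn
      refine ⟨LinearPMap.sSup c hd, ?_, fun z hz => LinearPMap.le_sSup hd hz⟩
      change SyzExact S k (P ⧸ sSup (LinearPMap.domain '' c))
      refine syzExact_quotient_sSup (c := LinearPMap.domain '' c) ⟨_, g, hg, rfl⟩ ?_ ?_
      · rintro _ ⟨a, ha, rfl⟩ _ ⟨b, hb, rfl⟩
        obtain ⟨d, hd, had, hbd⟩ := hd a ha b hb
        exact ⟨_, ⟨d, hd, rfl⟩, had.1, hbd.1⟩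
      · rintro _ ⟨a, ha, rfl⟩
        exact hc ha) g₀ hK
  have htop : g.domain = ⊤ := by
    by_contra hne
    obtain ⟨g', hlt, hg'⟩ := hN.exists_lt g hmax.1 hne
    exact hlt.not_ge (hmax.2 hg' hlt.le)
  refine ⟨g.toFun ∘ₗ LinearMap.codRestrict g.domain LinearMap.id (fun x => htop ▸ trivial), ?_⟩
  ext x
  exact (hle.2 (x := x) (y := ⟨x, htop ▸ trivial⟩) rfl).symm

end Extend

/-! ### The character module of the ring as a test object -/

section CharDual

/-- The group of additive characters of `S`, as a left `S`-module. -/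
def CharDual (S : Type u) [Ring S] : Type u := S →+ AddCircle (1 : ℚ)

variable {S : Type u} [Ring S]

instance : AddCommGroup (CharDual S) := inferInstanceAs (AddCommGroup (S →+ AddCircle (1 : ℚ)))

instance : FunLike (CharDual S) S (AddCircle (1 : ℚ)) :=
  inferInstanceAs (FunLike (S →+ AddCircle (1 : ℚ)) S (AddCircle (1 : ℚ)))

instance : AddMonoidHomClass (CharDual S) S (AddCircle (1 : ℚ)) :=
  inferInstanceAs (AddMonoidHomClass (S →+ AddCircle (1 : ℚ)) S (AddCircle (1 : ℚ)))

instance : SMul S (CharDual S) :=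
  ⟨fun s φ => AddMonoidHom.comp (φ : S →+ AddCircle (1 : ℚ)) (AddMonoidHom.mulRight s)⟩

namespace CharDual

@[ext] lemma ext {φ ψ : CharDual S} (h : ∀ x, φ x = ψ x) : φ = ψ := DFunLike.ext _ _ h

@[simp] lemma add_apply (φ ψ : CharDual S) (x : S) : (φ + ψ) x = φ x + ψ x := rfl

@[simp] lemma zero_apply (x : S) : (0 : CharDual S) x = 0 := rfl

@[simp] lemma smul_apply (s : S) (φ : CharDual S) (x : S) : (s • φ) x = φ (x * s) := rfl

instance : Module S (CharDual S) where
  one_smul φ := by ext; simp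
  mul_smul s t φ := by ext; simp [mul_assoc]
  smul_zero s := by ext; simp
  smul_add s φ ψ := by ext; simp
  add_smul s t φ := by ext; simp [mul_add]
  zero_smul φ := by ext; simp

/-- Evaluation at a fixed argument. -/
def evalHom (x : S) : CharDual S →+ AddCircle (1 : ℚ) where
  toFun φ := φ x
  map_zero' := rfl
  map_add' _ _ := rfl

@[simp] lemma sum_apply {ι : Type*} (s : Finset ι) (φ : ι → CharDual S) (x : S) :
    (∑ i ∈ s, φ i) x = ∑ i ∈ s, φ i x := map_sum (evalHom x) φ s

/-- The homomorphism to `(S⁺)^n` attached to an additive character of `V^n`. -/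
def ofChar {V : Type*} [AddCommGroup V] [Module S V] {n : Type*} [DecidableEq n]
    (β : (n → V) →+ AddCircle (1 : ℚ)) : V →ₗ[S] (n → CharDual S) where
  toFun v i := β.comp ((AddMonoidHom.single (fun _ => V) i).comp
    ((AddMonoidHom.flip (smulAddHom S V)) v))
  map_add' v w := by
    ext i x
    change β (Pi.single i (x • (v + w))) = β (Pi.single i (x • v)) + β (Pi.single i (x • w))
    rw [smul_add, Pi.single_add, map_add]
  map_smul' s v := by
    ext i x
    change β (Pi.single i (x • s • v)) = β (Pi.single i ((x * s) • v))
    rw [mul_smul]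

lemma ofChar_apply {V : Type*} [AddCommGroup V] [Module S V] {n : Type*} [DecidableEq n]
    (β : (n → V) →+ AddCircle (1 : ℚ)) (v : V) (i : n) (x : S) :
    ofChar β v i x = β (Pi.single i (x • v)) := rfl

/-- The additive character of `V^n` attached to a homomorphism to `(S⁺)^n`. -/
def toChar {V : Type*} [AddCommGroup V] [Module S V] {n : Type*} [Fintype n]
    (a : V →ₗ[S] (n → CharDual S)) : (n → V) →+ AddCircle (1 : ℚ) where
  toFun v := ∑ i, a (v i) i 1
  map_zero' := by simp
  map_add' v w := by simp [Finset.sum_add_distrib]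

lemma toChar_apply {V : Type*} [AddCommGroup V] [Module S V] {n : Type*} [Fintype n]
    (a : V →ₗ[S] (n → CharDual S)) (v : n → V) : toChar a v = ∑ i, a (v i) i 1 := rfl

/-- The endomorphism of `S⁺` induced by left multiplication with an element of `S`. -/
def precomp (s : S) : CharDual S →ₗ[S] CharDual S where
  toFun φ := AddMonoidHom.comp (φ : S →+ AddCircle (1 : ℚ)) (AddMonoidHom.mulLeft s)
  map_add' _ _ := rfl
  map_smul' t φ := by
    ext x
    change φ (s * x * t) = φ (s * (x * t))
    rw [mul_assoc]

@[simp] lemma precomp_apply (s : S) (φ : CharDual S) (x : S) : precomp s φ x = φ (s * x) := rfl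

/-- The transpose `(S⁺)^r → (S⁺)^q` of a matrix. -/
def transpose {r q : Type*} [Fintype r] (B : Matrix r q S) :
    (r → CharDual S) →ₗ[S] (q → CharDual S) :=
  LinearMap.pi fun i => ∑ j, precomp (B j i) ∘ₗ LinearMap.proj j

lemma transpose_apply {r q : Type*} [Fintype r] (B : Matrix r q S) (φ : r → CharDual S) (i : q)
    (x : S) : transpose B φ i x = ∑ j, φ j (B j i * x) := by
  simp [transpose]

lemma transpose_transpose {r q p : Type*} [Fintype r] [Fintype q] (B : Matrix r q S)
    (A : Matrix q p S) (φ : r → CharDual S) :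
    transpose A (transpose B φ) = transpose (B * A) φ := by
  ext i x
  simp only [transpose_apply, Matrix.mul_apply, Finset.sum_mul, map_sum, mul_assoc]
  rw [Finset.sum_comm]

/-- Under the identification of homomorphisms into powers of `CharDual S` with characters of powers
of `V`, composing with `transpose B` is pulling a character back along `B`. -/
lemma toChar_colAct {V : Type*} [AddCommGroup V] [Module S V] {r q : Type*} [Fintype r]
    [Fintype q] (a : V →ₗ[S] (r → CharDual S)) (B : Matrix r q S) (v : q → V) :
    toChar a (colAct V B v) = toChar (transpose B ∘ₗ a) v := by
  simp only [toChar_apply, colAct_apply, LinearMap.comp_apply, transpose_apply, map_sum, map_smul,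
    Finset.sum_apply, sum_apply, Pi.smul_apply, smul_apply, one_mul, mul_one]
  rw [Finset.sum_comm]

lemma toChar_ofChar {V : Type*} [AddCommGroup V] [Module S V] {n : Type*} [Fintype n]
    [DecidableEq n] (β : (n → V) →+ AddCircle (1 : ℚ)) : toChar (ofChar (S := S) β) = β := by
  refine AddMonoidHom.ext fun v => ?_
  simp only [toChar_apply, ofChar_apply, one_smul]
  rw [← map_sum, Finset.univ_sum_single]

lemma toChar_injective {V : Type*} [AddCommGroup V] [Module S V] {n : Type*} [Fintype n] :
    Function.Injective (toChar (S := S) (V := V) (n := n)) := by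
  classical
  intro a b h
  have key : ∀ (c : V →ₗ[S] (n → CharDual S)) v i x, c v i x = toChar c (Pi.single i (x • v)) := by
    intro c v i x
    rw [toChar_apply, Finset.sum_eq_single i]
    · simp
    · intro j _ hj
      simp [Pi.single_eq_of_ne hj]
    · simp
  ext v i x
  rw [key, key, h]

end CharDual

lemma exists_addMonoidHom_extension {A M : Type*} [AddCommGroup A] [AddCommGroup M] (f : M →+ A)
    (v : M →+ AddCircle (1 : ℚ)) (h : ∀ m, f m = 0 → v m = 0) :
    ∃ β : A →+ AddCircle (1 : ℚ), ∀ m, β (f m) = v m := by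
  obtain ⟨g, hdom, hg⟩ := exists_linearPMap f.toIntLinearMap v.toIntLinearMap (fun m hm => h m hm)
  obtain ⟨β, hβ⟩ := CharacterModule.dual_surjective_of_injective g.domain.subtype
    Subtype.val_injective (g.toFun.toAddMonoidHom : g.domain →+ AddCircle (1 : ℚ))
  refine ⟨β, fun m => ?_⟩
  have hm : f m ∈ g.domain := hdom ▸ ⟨m, rfl⟩
  have h1 := DFunLike.congr_fun hβ (⟨f m, hm⟩ : g.domain)
  exact h1.trans (hg m ⟨f m, hm⟩ rfl)

-- In terms of characters, `c` is a character of `V^r` prescribed on `K^r` by `a` and on the image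
-- of `B` by `b`. Divisibility of `ℚ/ℤ` provides it once the prescriptions agree on overlaps. If `B
-- f` lies in `K^r`, exactness modulo `K` writes `f` as an element of `K^q` plus a multiple of `A`;
-- `b` kills the latter and matches `a` on the former.
open CharDual in
lemma exists_lift_transpose {V : Type*} [AddCommGroup V] [Module S V] (K : Submodule S V)
    {p q r : ℕ} {B : Matrix (Fin r) (Fin q) S} {A : Matrix (Fin q) (Fin p) S}
    (hBA : B * A = 0) (hK : ExactAt B A (V ⧸ K)) (a : K →ₗ[S] (Fin r → CharDual S))
    (b : V →ₗ[S] (Fin q → CharDual S)) (hb : ∀ v, transpose A (b v) = 0)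
    (hab : ∀ v : K, transpose B (a v) = b v) :
    ∃ c : V →ₗ[S] (Fin r → CharDual S), (∀ v : K, c v = a v) ∧ ∀ v, transpose B (c v) = b v := by
  have hb' : ∀ g, toChar b (colAct V A g) = 0 := fun g => by
    rw [toChar_colAct, toChar_apply]
    simp [hb]
  have hab' : ∀ k : Fin q → K, toChar a (colAct K B k) = toChar b (K.subtype ∘ k) := fun k => by
    rw [toChar_colAct]
    simp [toChar_apply, hab]
  let ι : (Fin r → K) →+ (Fin r → V) := AddMonoidHom.compLeft K.subtype.toAddMonoidHom _
  have hι : ∀ k, ι k = K.subtype ∘ k := fun _ => rfl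
  obtain ⟨β, hβ⟩ := exists_addMonoidHom_extension (ι.coprod (colAct V B))
    ((toChar a).coprod (toChar b)) (by
      rintro ⟨k, f⟩ h
      simp only [AddMonoidHom.coprod_apply, hι] at h ⊢
      obtain ⟨g, hg⟩ := hK (K.mkQ ∘ f) (by
        rw [colAct_map, ← neg_eq_of_add_eq_zero_right h]
        ext i
        simp)
      obtain ⟨g', rfl⟩ : ∃ e', K.mkQ ∘ e' = g := ⟨fun i => (K.mkQ_surjective (g i)).choose,
        funext fun i => (K.mkQ_surjective (g i)).choose_spec⟩
      rw [colAct_map] at hg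
      obtain ⟨k', hk'⟩ : ∃ k' : Fin q → K, K.subtype ∘ k' = f - colAct V A g' := by
        refine ⟨fun i => ⟨(f - colAct V A g') i, ?_⟩, rfl⟩
        rw [← Submodule.Quotient.mk_eq_zero]
        have := congrFun hg i
        simp only [Function.comp_apply, Submodule.mkQ_apply] at this
        simp [this]
      have h1 : toChar b f = toChar b (K.subtype ∘ k') := by
        rw [hk', map_sub, hb', sub_zero]
      have h2 : K.subtype ∘ colAct K B k' = K.subtype ∘ (-k) := by
        rw [← colAct_map, hk', map_sub, colAct_mul, hBA, colAct_zero, sub_zero,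
          ← neg_eq_of_add_eq_zero_right h]
        ext i
        simp
      have h3 : colAct K B k' = -k := by
        ext i
        simpa using congrFun h2 i
      rw [h1, ← hab', h3, map_neg, add_neg_cancel])
  have hc1 : ofChar (S := S) β ∘ₗ K.subtype = a := by
    apply toChar_injective
    refine AddMonoidHom.ext fun k => ?_
    have := hβ (k, 0)
    simp only [AddMonoidHom.coprod_apply, map_zero, add_zero, hι] at this
    rw [← this]
    conv_rhs => rw [← toChar_ofChar (S := S) β]
    rfl
  have hc2 : transpose B ∘ₗ ofChar (S := S) β = b := by
    apply toChar_injective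
    refine AddMonoidHom.ext fun f => ?_
    have := hβ (0, f)
    simp only [AddMonoidHom.coprod_apply, map_zero, zero_add] at this
    rw [← this, ← toChar_colAct, toChar_ofChar]
  exact ⟨ofChar β, fun v => LinearMap.congr_fun hc1 v, fun v => LinearMap.congr_fun hc2 v⟩

-- Otherwise some character kills the image of `A` but not `e`. It corresponds to a `b` killed by
-- `transpose A`; lifting `b` through `transpose B` makes the character factor through `B`, which
-- kills `e`.
open CharDual in
lemma exactAt_of_lift {W : Type*} [AddCommGroup W] [Module S W]
    {p q r : ℕ} {B : Matrix (Fin r) (Fin q) S} {A : Matrix (Fin q) (Fin p) S}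
    (h : ∀ b : W →ₗ[S] (Fin q → CharDual S), (∀ w, transpose A (b w) = 0) →
      ∃ c : W →ₗ[S] (Fin r → CharDual S), ∀ w, transpose B (c w) = b w) : ExactAt B A W := by
  intro e he
  by_contra hne
  have hmem : (QuotientAddGroup.mk e : (Fin q → W) ⧸ (colAct W A).range) ≠ 0 := by
    rw [Ne, QuotientAddGroup.eq_zero_iff]
    exact hne
  obtain ⟨χ, hχ⟩ := CharacterModule.exists_character_apply_ne_zero_of_ne_zero hmem
  let χ' : (Fin q → W) →+ AddCircle (1 : ℚ) := AddMonoidHom.comp (χ : _ →+ AddCircle (1 : ℚ))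
    (QuotientAddGroup.mk' (colAct W A).range)
  have hχA : ∀ f, χ' (colAct W A f) = 0 := fun f => by
    have : (QuotientAddGroup.mk' (colAct W A).range) (colAct W A f) = 0 :=
      (QuotientAddGroup.eq_zero_iff _).2 ⟨f, rfl⟩
    change χ ((QuotientAddGroup.mk' (colAct W A).range) (colAct W A f)) = 0
    rw [this]
    exact map_zero (χ : _ →+ AddCircle (1 : ℚ))
  have hzero : transpose A ∘ₗ ofChar (S := S) χ' = 0 := by
    apply toChar_injective
    refine AddMonoidHom.ext fun f => ?_
    rw [← toChar_colAct, toChar_ofChar, hχA, toChar_apply]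
    simp
  obtain ⟨c, hc⟩ := h (ofChar χ') (fun w => LinearMap.congr_fun hzero w)
  apply hχ
  change χ' e = 0
  have hc' : transpose B ∘ₗ c = ofChar χ' := LinearMap.ext hc
  rw [← toChar_ofChar (S := S) χ', ← hc', ← toChar_colAct, he, map_zero]

end CharDual

/-! ### The cover by the small object argument -/

section SmallObject

variable (S : Type u) [Ring S] (k : ℕ)

variable {S} in
/-- The inclusion of a submodule of the free module on `PureTerm S`. -/
noncomputable def submoduleInclusion (K : Submodule S (PureTerm S →₀ S)) :
    ModuleCat.of S K ⟶ ModuleCat.of S (PureTerm S →₀ S) :=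
  ModuleCat.ofHom (X := K) (Y := PureTerm S →₀ S) K.subtype

instance (K : Submodule S (PureTerm S →₀ S)) : Mono (submoduleInclusion K) :=
  (ModuleCat.mono_iff_injective _).2 Subtype.val_injective

/-- The inclusions of submodules of the free module on `PureTerm S` with `SyzExact` quotients. -/
def smallMonos : MorphismProperty (ModuleCat.{u} S) :=
  MorphismProperty.ofHoms (fun K : {K : Submodule S (PureTerm S →₀ S) //
    SyzExact S k ((PureTerm S →₀ S) ⧸ K)} => submoduleInclusion K.1)

variable {S k} in
lemma smallMonos_submoduleInclusion {K : Submodule S (PureTerm S →₀ S)}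
    (hK : SyzExact S k ((PureTerm S →₀ S) ⧸ K)) : smallMonos S k (submoduleInclusion K) :=
  MorphismProperty.ofHoms.mk (f := fun K : {K : Submodule S (PureTerm S →₀ S) //
    SyzExact S k ((PureTerm S →₀ S) ⧸ K)} => submoduleInclusion K.1) ⟨K, hK⟩

lemma smallMonos_le : smallMonos S k ≤ MorphismProperty.monomorphisms (ModuleCat.{u} S) := by
  rintro _ _ _ ⟨K⟩
  exact inferInstanceAs (Mono (submoduleInclusion K.1))

open MorphismProperty Limits in
instance : HasSmallObjectArgument.{u} (smallMonos S k) := by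
  -- With `κ` above the number of subobjects of the free module, each generator `K` is small
  -- relative to `κ`-chains of monomorphisms, and all relative cell complexes here are such chains.
  obtain ⟨κ, hκ', hκ⟩ := HasCardinalLT.exists_regular_cardinal.{u}
    (Subobject (ModuleCat.of S (PureTerm S →₀ S)))
  have : Fact κ.IsRegular := ⟨hκ'⟩
  have : Nonempty κ.ord.ToType := by simpa using hκ'.ne_zero
  have := WellFoundedLT.toOrderBot κ.ord.ToType
  have : IsSmall.{u} (smallMonos S k) := by
    unfold smallMonos
    infer_instance
  exact ⟨κ, inferInstance, inferInstance,
    { preservesColimit {A B X Y} i hi f hf := by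
        let hf' : (monomorphisms (ModuleCat.{u} S)).TransfiniteCompositionOfShape κ.ord.ToType f :=
          { toTransfiniteCompositionOfShape := hf.toTransfiniteCompositionOfShape
            map_mem j hj := by
              have := (hf.attachCells j hj).pushouts_coproducts
              simp only [ofHoms_homFamily] at this
              refine (?_ : _ ≤ monomorphisms _) _ this
              rw [pushouts_le_iff]
              exact (coproducts_monotone (smallMonos_le S k)).trans (coproducts_le _) }
        have (j j' : κ.ord.ToType) (φ : j ⟶ j') : Mono (hf'.F.map φ) := hf'.mem_map φ
        apply IsGrothendieckAbelian.preservesColimit_coyoneda_obj_of_mono (Y := hf'.F) (κ := κ)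
        obtain ⟨K⟩ := hi
        exact Subobject.hasCardinalLT_of_mono hκ (submoduleInclusion K.1) }⟩

variable {S k}

open CharDual in
lemma smallMonos_rlp_transpose {p q r : ℕ} {B : Matrix (Fin r) (Fin q) S}
    {A : Matrix (Fin q) (Fin p) S} (hA : RowSyz k A) (hBA : RowExact B A)
    (t : (Fin r → CharDual S) →ₗ[S] LinearMap.ker (transpose A))
    (ht : ∀ φ, (t φ : Fin q → CharDual S) = transpose B φ) :
    (smallMonos S k).rlp (ModuleCat.ofHom t) := by
  rintro _ _ _ ⟨K⟩
  refine ⟨fun {a b} sq => ?_⟩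
  have hsq : ∀ v : K.1, t (a.hom v) = b.hom v := fun v =>
    LinearMap.congr_fun (congrArg ModuleCat.Hom.hom sq.w) v
  obtain ⟨c, hc1, hc2⟩ := exists_lift_transpose K.1 hBA.mul_eq_zero (K.2 B A hA hBA) a.hom
    ((LinearMap.ker (transpose A)).subtype ∘ₗ b.hom) (fun v => (b.hom v).2) (fun v => by
      rw [← ht, hsq]
      rfl)
  refine ⟨⟨⟨ModuleCat.ofHom c, ?_, ?_⟩⟩⟩
  · refine ModuleCat.hom_ext (LinearMap.ext fun v => ?_)
    exact hc1 v
  · refine ModuleCat.hom_ext (LinearMap.ext fun v => ?_)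
    exact Subtype.ext ((ht _).trans (hc2 v))

-- The lifting property replaces an induction along the transfinite filtration of `W`:
-- `smallMonos_rlp_transpose` supplies exactly the lifts demanded by `exactAt_of_lift`.
open CharDual in
lemma syzExact_of_llp_rlp {W : ModuleCat.{u} S} {Z : ModuleCat.{u} S} (hZ : Subsingleton Z)
    (i : Z ⟶ W) (hi : (smallMonos S k).rlp.llp i) : SyzExact S k W := by
  intro r q p B A hA hBA
  refine exactAt_of_lift fun b hb => ?_
  let t : (Fin r → CharDual S) →ₗ[S] LinearMap.ker (transpose A) :=
    (transpose B).codRestrict _ fun φ => by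
      rw [LinearMap.mem_ker, transpose_transpose, hBA.mul_eq_zero]
      ext i x
      simp [transpose_apply]
  have := hi _ (smallMonos_rlp_transpose hA hBA t fun _ => rfl)
  let b' : W ⟶ ModuleCat.of S (LinearMap.ker (transpose A)) :=
    ModuleCat.ofHom (b.codRestrict _ hb)
  have sq : CommSq (0 : Z ⟶ ModuleCat.of S (Fin r → CharDual S)) i (ModuleCat.ofHom t) b' := ⟨by
    ext z
    rw [Subsingleton.elim z 0, map_zero, map_zero]⟩
  refine ⟨sq.lift.hom, fun w => ?_⟩
  exact congrArg Subtype.val (LinearMap.congr_fun (congrArg ModuleCat.Hom.hom sq.fac_right) w)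

theorem exists_syzExact_cover (hS : SyzExact S k S) (N : ModuleCat.{u} S) :
    ∃ (W : ModuleCat.{u} S) (g : W ⟶ N), SyzExact S k W ∧ Function.Surjective g ∧
      ExtendsSmall S k (LinearMap.ker g.hom) := by
  let d := MorphismProperty.factorizationData (smallMonos S k).rlp.llp (smallMonos S k).rlp
    (0 : ModuleCat.of S PUnit.{u + 1} ⟶ N)
  refine ⟨d.Z, d.p, syzExact_of_llp_rlp (inferInstanceAs (Subsingleton PUnit)) d.i d.hi, ?_, ?_⟩
  · intro x
    -- Surjectivity is lifting against the generator with `K = ⊥`, which is allowed because free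
    -- modules are `SyzExact`.
    have hK : SyzExact S k ((PureTerm S →₀ S) ⧸ (⊥ : Submodule S (PureTerm S →₀ S))) :=
      SyzExact.of_linearEquiv (Submodule.quotEquivOfEqBot _ rfl).symm (hS.finsupp _)
    have := d.hp _ (smallMonos_submoduleInclusion hK)
    let b : ModuleCat.of S (PureTerm S →₀ S) ⟶ N :=
      ModuleCat.ofHom (Finsupp.linearCombination S fun _ => x)
    have sq : CommSq (0 : _ ⟶ d.Z) (submoduleInclusion ⊥) d.p b := ⟨by
      ext z
      have : z = 0 := Subsingleton.elim (α := (⊥ : Submodule S (PureTerm S →₀ S))) z 0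
      rw [this, map_zero, map_zero]⟩
    refine ⟨sq.lift.hom (Finsupp.single default 1), ?_⟩
    have := LinearMap.congr_fun (congrArg ModuleCat.Hom.hom sq.fac_right) (Finsupp.single default 1)
    refine Eq.trans this ?_
    simp [b]
  · intro K hK φ
    have := d.hp _ (smallMonos_submoduleInclusion hK)
    -- The bottom map is zero, so the lift takes values in the kernel.
    have sq : CommSq (ModuleCat.ofHom ((LinearMap.ker d.p.hom).subtype ∘ₗ φ))
        (submoduleInclusion K) d.p 0 := ⟨by
      ext z
      exact (φ z).2⟩
    have h1 := fun v => LinearMap.congr_fun (congrArg ModuleCat.Hom.hom sq.fac_right) v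
    have h2 := fun v => LinearMap.congr_fun (congrArg ModuleCat.Hom.hom sq.fac_left) v
    refine ⟨sq.lift.hom.codRestrict _ fun v => h1 v, ?_⟩
    ext v
    exact h2 v

end SmallObject

/-! ### Consequences of the long exact sequences of Ext -/

section ExtLemmas

open Abelian Limits

universe w v'

variable {C : Type*} [Category.{v'} C] [Abelian C] [HasExt.{w} C] {T : ShortComplex C}

namespace CategoryTheory.ShortComplex.ShortExact

lemma exists_extension (hT : T.ShortExact) {N : C} (h : Subsingleton (Ext T.X₃ N 1))
    (φ : T.X₁ ⟶ N) : ∃ ψ : T.X₂ ⟶ N, T.f ≫ ψ = φ := by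
  obtain ⟨x, hx⟩ := Ext.contravariant_sequence_exact₁ hT N (Ext.mk₀ φ) (add_zero 1)
    (Subsingleton.elim _ _)
  obtain ⟨ψ, rfl⟩ := (Ext.mk₀_bijective _ _).2 x
  refine ⟨ψ, (Ext.mk₀_bijective _ _).1 ?_⟩
  rw [← hx, Ext.mk₀_comp_mk₀]

lemma exists_lift (hT : T.ShortExact) {W : C} (h : Subsingleton (Ext W T.X₁ 1))
    (φ : W ⟶ T.X₃) : ∃ ψ : W ⟶ T.X₂, ψ ≫ T.g = φ := by
  obtain ⟨x, hx⟩ := Ext.covariant_sequence_exact₃ W hT (Ext.mk₀ φ) (zero_add 1)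
    (Subsingleton.elim _ _)
  obtain ⟨ψ, rfl⟩ := (Ext.mk₀_bijective _ _).2 x
  refine ⟨ψ, (Ext.mk₀_bijective _ _).1 ?_⟩
  rw [← hx, Ext.mk₀_comp_mk₀]

lemma subsingleton_ext_of_extension (hT : T.ShortExact) [Projective T.X₂] {N : C}
    (h : ∀ φ : T.X₁ ⟶ N, ∃ ψ : T.X₂ ⟶ N, T.f ≫ ψ = φ) : Subsingleton (Ext T.X₃ N 1) := by
  refine subsingleton_of_forall_eq 0 fun x => ?_
  obtain ⟨y, rfl⟩ := Ext.contravariant_sequence_exact₃ hT N x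
    (Ext.eq_zero_of_projective _) (add_zero 1)
  obtain ⟨φ, rfl⟩ := (Ext.mk₀_bijective _ _).2 y
  obtain ⟨ψ, rfl⟩ := h φ
  rw [← Ext.mk₀_comp_mk₀, ShortComplex.ShortExact.extClass_comp_assoc]

lemma subsingleton_ext_of_lift (hT : T.ShortExact) [Injective T.X₂] {W : C}
    (h : ∀ φ : W ⟶ T.X₃, ∃ ψ : W ⟶ T.X₂, ψ ≫ T.g = φ) : Subsingleton (Ext W T.X₁ 1) := by
  refine subsingleton_of_forall_eq 0 fun x => ?_
  obtain ⟨y, rfl⟩ := Ext.covariant_sequence_exact₁ W hT x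
    (Ext.eq_zero_of_injective _) (zero_add 1)
  obtain ⟨φ, rfl⟩ := (Ext.mk₀_bijective _ _).2 y
  obtain ⟨ψ, rfl⟩ := h φ
  rw [← Ext.mk₀_comp_mk₀, Ext.comp_assoc_of_second_deg_zero, ShortComplex.ShortExact.comp_extClass,
    Ext.comp_zero]

lemma subsingleton_ext_succ_iff (hT : T.ShortExact) [Projective T.X₂] (N : C) (k : ℕ) :
    Subsingleton (Ext T.X₃ N (k + 1 + 1)) ↔ Subsingleton (Ext T.X₁ N (k + 1)) := by
  constructor
  · intro h
    refine subsingleton_of_forall_eq 0 fun x => ?_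
    obtain ⟨y, rfl⟩ := Ext.contravariant_sequence_exact₁ hT N x (n₁ := k + 1 + 1) (by lia)
      (Subsingleton.elim _ _)
    rw [Ext.eq_zero_of_projective y, Ext.comp_zero]
  · intro h
    refine subsingleton_of_forall_eq 0 fun x => ?_
    obtain ⟨y, rfl⟩ := Ext.contravariant_sequence_exact₃ hT N x (n₀ := k + 1)
      (Ext.eq_zero_of_projective _) (by lia)
    rw [Subsingleton.elim y 0, Ext.comp_zero]

lemma subsingleton_ext_extension (hT : T.ShortExact) {W : C} {n : ℕ}
    (h₁ : Subsingleton (Ext W T.X₁ n)) (h₃ : Subsingleton (Ext W T.X₃ n)) :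
    Subsingleton (Ext W T.X₂ n) := by
  refine subsingleton_of_forall_eq 0 fun x => ?_
  obtain ⟨y, rfl⟩ := Ext.covariant_sequence_exact₂ W hT x (Subsingleton.elim _ _)
  rw [Subsingleton.elim y 0, Ext.zero_comp]

end CategoryTheory.ShortComplex.ShortExact

lemma subsingleton_ext_of_iso {X Y : C} (e : X ≅ Y) {N : C} {n : ℕ}
    (h : Subsingleton (Ext X N n)) : Subsingleton (Ext Y N n) := by
  refine subsingleton_of_forall_eq 0 fun x => ?_
  rw [← Ext.mk₀_id_comp x, ← e.inv_hom_id, ← Ext.mk₀_comp_mk₀_assoc, Subsingleton.elim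
    ((Ext.mk₀ e.hom).comp x (zero_add n)) 0, Ext.comp_zero]

lemma subsingleton_ext_of_iso_right {N N' : C} (e : N ≅ N') {W : C} {n : ℕ}
    (h : Subsingleton (Ext W N n)) : Subsingleton (Ext W N' n) := by
  refine subsingleton_of_forall_eq 0 fun x => ?_
  rw [← Ext.comp_mk₀_id x, ← e.inv_hom_id, ← Ext.mk₀_comp_mk₀,
    ← Ext.comp_assoc_of_third_deg_zero, Subsingleton.elim
    (x.comp (Ext.mk₀ e.inv) (add_zero n)) 0, Ext.zero_comp]

end ExtLemmas

/-! ### Translating Ext and FP-injective dimension into matrices -/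

section Bridge

open Abelian Matrix

variable {S : Type u} [Ring S]

/-- The cokernel of right multiplication by a matrix. -/
abbrev Matrix.rowCoker {q p : ℕ} (A : Matrix (Fin q) (Fin p) S) : ModuleCat.{u} S :=
  ModuleCat.of S ((Fin p → S) ⧸ LinearMap.range A.vecMulLinear)

lemma Matrix.rowCoker_finitePresentation {q p : ℕ} (A : Matrix (Fin q) (Fin p) S) :
    Module.FinitePresentation S A.rowCoker :=
  Module.finitePresentation_of_surjective (Submodule.mkQ _) (Submodule.mkQ_surjective _) (by
    rw [Submodule.ker_mkQ, LinearMap.range_eq_map]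
    exact Module.Finite.fg_top.map _)

lemma exists_rowCoker_iso (F : ModuleCat.{u} S) (hF : Module.FinitePresentation S F) :
    ∃ (q p : ℕ) (A : Matrix (Fin q) (Fin p) S), Nonempty (A.rowCoker ≅ F) := by
  obtain ⟨p, q, f, g, hf, hfg⟩ := Module.FinitePresentation.exists_fin' S F
  let A : Matrix (Fin q) (Fin p) S := Matrix.of fun i j => g (Pi.single i 1) j
  have hA : A.vecMulLinear = g := by
    refine LinearMap.pi_ext' fun i => LinearMap.ext_ring ?_
    ext j
    simp [A]
  refine ⟨q, p, A, ⟨LinearEquiv.toModuleIso ?_⟩⟩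
  exact (Submodule.quotEquivOfEq _ _ (by rw [hA, (LinearMap.exact_iff.1 hfg)])).trans
    (f.quotKerEquivOfSurjective hf)

variable {r q p : ℕ} {B : Matrix (Fin r) (Fin q) S} {A : Matrix (Fin q) (Fin p) S}

lemma RowExact.range_eq_ker (h : RowExact B A) :
    LinearMap.range B.vecMulLinear = LinearMap.ker A.vecMulLinear := by
  ext x
  exact (h x).symm

lemma RowExact.exists_shortExact (h : RowExact B A) :
    ∃ T : ShortComplex (ModuleCat.{u} S), T.ShortExact ∧ T.X₁ = B.rowCoker ∧
      T.X₂ = ModuleCat.of S (Fin p → S) ∧ T.X₃ = A.rowCoker := by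
  let f : (Fin q → S) ⧸ LinearMap.range B.vecMulLinear →ₗ[S] (Fin p → S) :=
    (LinearMap.range B.vecMulLinear).liftQ A.vecMulLinear h.range_eq_ker.le
  have hf : LinearMap.range f = LinearMap.range A.vecMulLinear := Submodule.range_liftQ _ _ _
  refine ⟨ModuleCat.shortComplexOfCompEqZero f (LinearMap.range A.vecMulLinear).mkQ ?_,
    ModuleCat.shortComplex_shortExact _ ?_ ?_ ?_, rfl, rfl, rfl⟩
  · rw [← LinearMap.range_le_ker_iff, hf, Submodule.ker_mkQ]
  · exact LinearMap.exact_iff.2 (by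
      change LinearMap.ker (LinearMap.range A.vecMulLinear).mkQ = LinearMap.range f
      rw [hf, Submodule.ker_mkQ])
  · exact LinearMap.ker_eq_bot.1 (Submodule.ker_liftQ_eq_bot _ _ _ h.range_eq_ker.ge)
  · exact Submodule.mkQ_surjective _

instance projective_fin (p : ℕ) : Projective (ModuleCat.of S (Fin p → S)) :=
  (IsProjective.iff_projective _).1 inferInstance

lemma RowExact.subsingleton_ext_succ_iff (h : RowExact B A) (N : ModuleCat.{u} S) (k : ℕ) :
    Subsingleton (Ext A.rowCoker N (k + 1 + 1)) ↔ Subsingleton (Ext B.rowCoker N (k + 1)) := by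
  obtain ⟨T, hT, h1, h2, h3⟩ := h.exists_shortExact
  have : Projective T.X₂ := h2 ▸ projective_fin p
  rw [← h1, ← h3]
  exact hT.subsingleton_ext_succ_iff N k

/-- A short complex formed by a submodule and its quotient. -/
abbrev Submodule.shortComplex {M : Type u} [AddCommGroup M] [Module S M] (K : Submodule S M) :
    ShortComplex (ModuleCat.{u} S) :=
  ModuleCat.shortComplexOfCompEqZero K.subtype K.mkQ (by ext; simp)

lemma Submodule.shortComplex_shortExact {M : Type u} [AddCommGroup M] [Module S M]
    (K : Submodule S M) : K.shortComplex.ShortExact :=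
  ModuleCat.shortComplex_shortExact _ (LinearMap.exact_subtype_mkQ K) Subtype.val_injective
    (Submodule.mkQ_surjective K)

lemma sum_smul_vecMul {E : Type*} [AddCommGroup E] [Module S E] (B : Matrix (Fin r) (Fin q) S)
    (e : Fin q → E) (x : Fin r → S) : ∑ j, (x ᵥ* B) j • e j = ∑ i, x i • colAct E B e i := by
  simp only [colAct_apply, Finset.smul_sum, Matrix.vecMul, dotProduct, Finset.sum_smul, mul_smul]
  rw [Finset.sum_comm]

/-- A map from the row space of `A` to `N` is a column over `N` killed by `B`, since the rows of `B`
generate the relations among the rows of `A`. It extends to `S^p` exactly when the column is a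
multiple of `A`. -/
lemma RowExact.subsingleton_ext_one_iff (h : RowExact B A) (N : ModuleCat.{u} S) :
    Subsingleton (Ext A.rowCoker N 1) ↔ ExactAt B A N := by
  let K := LinearMap.range A.vecMulLinear
  have hK := K.shortComplex_shortExact
  have hrow : ∀ i, A.vecMulLinear (Pi.single i 1) = A i := fun i => by simp [Matrix.row_def]
  constructor
  · intro hsub e he
    obtain ⟨g, hdom, hg⟩ := exists_linearPMap A.vecMulLinear (Fintype.linearCombination S e) (by
      rw [← h.range_eq_ker]
      rintro _ ⟨x, rfl⟩
      rw [LinearMap.mem_ker, Fintype.linearCombination_apply, Matrix.vecMulLinear_apply,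
        sum_smul_vecMul, he]
      simp)
    obtain ⟨ψ, hψ⟩ := hK.exists_extension hsub (ModuleCat.ofHom
      (g.toFun ∘ₗ (LinearEquiv.ofEq K g.domain hdom.symm).toLinearMap))
    refine ⟨fun j => ψ.hom (Pi.single j 1), ?_⟩
    ext i
    have h1 := LinearMap.congr_fun (congrArg ModuleCat.Hom.hom hψ) ⟨A i, ⟨_, hrow i⟩⟩
    have h2 := hg (Pi.single i 1) ⟨A i, hdom ▸ ⟨_, hrow i⟩⟩ (hrow i).symm
    have h3 : ψ.hom (A i) = e i := by
      refine h1.trans (Eq.trans ?_ (h2.trans ?_))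
      · rfl
      · simp [Fintype.linearCombination_apply, Pi.single_apply]
    rw [← h3, colAct_apply]
    conv_rhs => rw [← Finset.univ_sum_single (A i), map_sum]
    refine Finset.sum_congr rfl fun j _ => ?_
    rw [← map_smul, ← Pi.single_smul, smul_eq_mul, mul_one]
  · intro hex
    have : Projective K.shortComplex.X₂ := projective_fin p
    refine hK.subsingleton_ext_of_extension fun φ => ?_
    obtain ⟨f, hf⟩ := hex (fun i => φ.hom ⟨A i, ⟨_, hrow i⟩⟩) (by
      ext i
      have hB : (∑ j, B i j • (⟨A j, ⟨_, hrow j⟩⟩ : K)) = 0 := by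
        ext l
        simpa [Matrix.mul_apply] using congrFun (congrFun h.mul_eq_zero i) l
      have := congrArg φ.hom hB
      rw [map_zero, map_sum] at this
      rw [colAct_apply, Pi.zero_apply, ← this]
      exact Finset.sum_congr rfl fun j _ => (map_smul φ.hom _ _).symm)
    refine ⟨ModuleCat.ofHom (Fintype.linearCombination S f), ?_⟩
    refine ModuleCat.hom_ext (LinearMap.ext ?_)
    rintro ⟨_, x, rfl⟩
    change ∑ j, (x ᵥ* A) j • f j = _
    rw [sum_smul_vecMul, hf]
    have hx : (⟨A.vecMulLinear x, ⟨x, rfl⟩⟩ : K) = ∑ i, x i • (⟨A i, ⟨_, hrow i⟩⟩ : K) := by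
      ext l
      simp [Matrix.vecMul, dotProduct]
    rw [hx]
    refine Eq.trans ?_ (map_sum φ.hom _ _).symm
    exact Finset.sum_congr rfl fun j _ => (map_smul φ.hom _ _).symm

lemma subsingleton_ext_iff_syzExact (hR : RowCoherent S) (k : ℕ) (N : ModuleCat.{u} S) :
    (∀ F : ModuleCat.{u} S, Module.FinitePresentation S F → Subsingleton (Ext F N (k + 1))) ↔
      SyzExact S k N := by
  -- Generalizing over the syzygy position `j` lets the induction trade one degree of Ext for one
  -- step along the resolution, with `j + k` fixed.
  have key : ∀ k j : ℕ, (∀ {q p : ℕ} (A : Matrix (Fin q) (Fin p) S), RowSyz j A →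
      Subsingleton (Ext A.rowCoker N (k + 1))) ↔ SyzExact S (j + k) N := by
    intro k
    induction k with
    | zero =>
      intro j
      constructor
      · intro h r q p B A hA hBA
        exact (hBA.subsingleton_ext_one_iff N).1 (h A hA)
      · intro h q p A hA
        obtain ⟨r, B, hBA⟩ := hR A
        exact (hBA.subsingleton_ext_one_iff N).2 (h B A hA hBA)
    | succ k ih =>
      intro j
      rw [show j + (k + 1) = (j + 1) + k by lia, ← ih]
      constructor
      · rintro h q p B ⟨p', A, hA, hBA⟩
        exact (hBA.subsingleton_ext_succ_iff N k).1 (h A hA)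
      · intro h q p A hA
        obtain ⟨r, B, hBA⟩ := hR A
        exact (hBA.subsingleton_ext_succ_iff N k).2 (h B ⟨p, A, hA, hBA⟩)
  have h0 := key k 0
  rw [zero_add] at h0
  rw [← h0]
  constructor
  · intro h q p A _
    exact h _ A.rowCoker_finitePresentation
  · intro h F hF
    obtain ⟨q, p, A, ⟨e⟩⟩ := exists_rowCoker_iso F hF
    exact subsingleton_ext_of_iso e (h A trivial)

lemma isFPInjective_iff_syzExact (hR : RowCoherent S) (N : ModuleCat.{u} S) :
    IsFPInjective N ↔ SyzExact S 0 N :=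
  subsingleton_ext_iff_syzExact hR 0 N

lemma fpInjectiveDimension_lt_top_iff (hR : RowCoherent S) (N : ModuleCat.{u} S) :
    fpInjectiveDimension N < ⊤ ↔ ∃ k, SyzExact S k N := by
  simp only [fpInjectiveDimension, iInf_lt_iff, subsingleton_ext_iff_syzExact hR]
  exact ⟨fun ⟨k, h, _⟩ => ⟨k, h⟩, fun ⟨k, h⟩ => ⟨k, h, ENat.natCast_lt_top k⟩⟩

lemma syzExact_of_fpInjectiveDimension_eq (hR : RowCoherent S) {N : ModuleCat.{u} S} {n : ℕ}
    (h : fpInjectiveDimension N = n) : SyzExact S n N := by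
  have h1 : fpInjectiveDimension N < (n + 1 : ℕ) := by
    rw [h]
    exact_mod_cast Nat.lt_succ_self n
  simp only [fpInjectiveDimension, iInf_lt_iff, subsingleton_ext_iff_syzExact hR] at h1
  obtain ⟨k, hk, hkn⟩ := h1
  have hkn' : k ≤ n := Nat.lt_succ_iff.1 (by exact_mod_cast hkn)
  intro r q p B A hA hBA
  exact hk.mono hkn' B A hA hBA

end Bridge

/-! ### Kernels of matrices over coherent rings -/

section Coherent

open Matrix

variable {S : Type u} [Ring S]

/-- Induction on the number of target coordinates. Parametrize the kernel of all but the first by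
`g`; the remaining coordinate then maps onto a finitely generated left ideal, which is finitely
presented, so its kernel is finitely generated. -/
lemma IsLeftCoherentRing.fg_ker (h : IsLeftCoherentRing S) {q p : ℕ} :
    ∀ f : (Fin q → S) →ₗ[S] (Fin p → S), (LinearMap.ker f).FG := by
  induction p with
  | zero =>
    intro f
    rw [show f = 0 from Subsingleton.elim _ _, LinearMap.ker_zero]
    exact Module.Finite.fg_top
  | succ p ih =>
    intro f
    obtain ⟨m, g, hg⟩ := (Submodule.fg_iff_exists_fin_linearMap _ _).1
      (ih ((LinearMap.pi fun i => LinearMap.proj i.succ) ∘ₗ f))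
    let c : (Fin m → S) →ₗ[S] S := LinearMap.proj 0 ∘ₗ f ∘ₗ g
    have hc : (LinearMap.range c).FG := by
      rw [LinearMap.range_eq_map]
      exact Module.Finite.fg_top.map c
    have := h _ hc
    have hk : (LinearMap.ker c).FG := by
      rw [← LinearMap.ker_rangeRestrict]
      exact Module.FinitePresentation.fg_ker _ c.surjective_rangeRestrict
    have heq : LinearMap.ker f = (LinearMap.ker c).map g := by
      ext x
      constructor
      · intro hx
        have hx' : x ∈ LinearMap.range g := by
          rw [hg]
          have : f x = 0 := hx
          ext i
          simp [this]
        obtain ⟨y, rfl⟩ := hx'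
        refine ⟨y, ?_, rfl⟩
        have : f (g y) = 0 := hx
        change f (g y) 0 = 0
        rw [this]
        rfl
      · rintro ⟨y, hy, rfl⟩
        have h1 : g y ∈ LinearMap.range g := ⟨y, rfl⟩
        rw [hg] at h1
        change f (g y) = 0
        ext i
        refine Fin.cases ?_ (fun i => ?_) i
        · exact hy
        · exact congrFun (show _ = 0 from h1) i
    rw [heq]
    exact hk.map g

lemma IsLeftCoherentRing.rowCoherent (h : IsLeftCoherentRing S) : RowCoherent S := by
  intro q p A
  obtain ⟨r, g, hg⟩ := (Submodule.fg_iff_exists_fin_linearMap _ _).1 (h.fg_ker A.vecMulLinear)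
  let B : Matrix (Fin r) (Fin q) S := Matrix.of fun i j => g (Pi.single i 1) j
  have hB : B.vecMulLinear = g := by
    refine LinearMap.pi_ext' fun i => LinearMap.ext_ring ?_
    ext j
    simp [B]
  refine ⟨r, B, fun x => ?_⟩
  have : x ∈ LinearMap.range g ↔ x ∈ LinearMap.ker A.vecMulLinear := by rw [hg]
  rw [← hB] at this
  exact this.symm

lemma rowDual_of_syzExact {n : ℕ} (h : SyzExact S n S) : RowDual S n := by
  intro r q p B A hA hBA x
  constructor
  · intro hx
    obtain ⟨f, hf⟩ := h B A hA hBA x (by rw [colAct_self, hx])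
    exact ⟨f, by rw [← colAct_self, hf]⟩
  · rintro ⟨y, rfl⟩
    rw [Matrix.mulVec_mulVec, hBA.mul_eq_zero, Matrix.zero_mulVec]

end Coherent

/-! ### Transposition to the opposite ring -/

section Opposite

open Matrix

/-- The transpose of a matrix over `R`, with entries in the opposite ring. -/
def Matrix.opTranspose {m n R : Type*} (A : Matrix m n R) : Matrix n m Rᵐᵒᵖ :=
  Matrix.of fun i j => MulOpposite.op (A j i)

/-- The transpose of a matrix over the opposite ring, with entries in `R`. -/
def Matrix.unopTranspose {m n R : Type*} (A : Matrix m n Rᵐᵒᵖ) : Matrix n m R :=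
  Matrix.of fun i j => MulOpposite.unop (A j i)

lemma op_comp_eq_iff {n R : Type*} (x y : n → R) : MulOpposite.op ∘ x = MulOpposite.op ∘ y ↔ x = y :=
  MulOpposite.op_injective.comp_left.eq_iff

lemma forall_op_comp {n R : Type*} {P : (n → Rᵐᵒᵖ) → Prop} :
    (∀ x, P x) ↔ ∀ x : n → R, P (MulOpposite.op ∘ x) := ⟨fun h _ => h _, fun h x => h (MulOpposite.unop ∘ x)⟩

lemma exists_op_comp {n R : Type*} {P : (n → Rᵐᵒᵖ) → Prop} :
    (∃ x, P x) ↔ ∃ x : n → R, P (MulOpposite.op ∘ x) := ⟨fun ⟨x, h⟩ => ⟨MulOpposite.unop ∘ x, h⟩, fun ⟨_, h⟩ => ⟨_, h⟩⟩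

/-- A ring and its opposite are isomorphic as modules over the opposite ring. -/
def opSelfEquiv (R : Type u) [Ring R] : R ≃ₗ[Rᵐᵒᵖ] Rᵐᵒᵖ where
  toFun := MulOpposite.op
  invFun := MulOpposite.unop
  map_add' _ _ := rfl
  map_smul' _ _ := rfl
  left_inv _ := rfl
  right_inv _ := rfl

variable {R : Type u} [Ring R]

lemma IsRightCoherentRing.isLeftCoherentRing_op (h : IsRightCoherentRing R) :
    IsLeftCoherentRing Rᵐᵒᵖ := by
  intro I hI
  let e : R ≃ₗ[Rᵐᵒᵖ] Rᵐᵒᵖ := opSelfEquiv R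
  have := h (I.map e.symm.toLinearMap) (hI.map _)
  exact Module.FinitePresentation.of_equiv (e.symm.submoduleMap I).symm

lemma op_vecMul {m n : Type*} [Fintype m] (A : Matrix m n R) (x : m → R) :
    A.opTranspose *ᵥ (MulOpposite.op ∘ x) = MulOpposite.op ∘ (x ᵥ* A) := by
  ext i
  simp [Matrix.mulVec, Matrix.vecMul, dotProduct, Matrix.opTranspose]

lemma op_mulVec {m n : Type*} [Fintype n] (A : Matrix m n R) (x : n → R) :
    (MulOpposite.op ∘ x) ᵥ* A.opTranspose = MulOpposite.op ∘ (A *ᵥ x) := by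
  ext i
  simp [Matrix.mulVec, Matrix.vecMul, dotProduct, Matrix.opTranspose]

lemma op_comp_eq_zero_iff {n : Type*} (x : n → R) : MulOpposite.op ∘ x = 0 ↔ x = 0 :=
  op_comp_eq_iff x 0

variable {r q p : ℕ}

lemma colExact_opTranspose_iff {B : Matrix (Fin r) (Fin q) R} {A : Matrix (Fin q) (Fin p) R} :
    ColExact A.opTranspose B.opTranspose ↔ RowExact B A := by
  simp only [ColExact, RowExact, forall_op_comp, exists_op_comp, op_vecMul, op_comp_eq_iff,
    op_comp_eq_zero_iff]

lemma rowExact_opTranspose_iff {B : Matrix (Fin r) (Fin q) R} {A : Matrix (Fin q) (Fin p) R} :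
    RowExact A.opTranspose B.opTranspose ↔ ColExact B A := by
  simp only [ColExact, RowExact, forall_op_comp, exists_op_comp, op_mulVec, op_comp_eq_iff,
    op_comp_eq_zero_iff]

lemma RowCoherent.op (h : RowCoherent R) : ColCoherent Rᵐᵒᵖ := by
  intro r q B
  obtain ⟨p, A, hA⟩ := h B.unopTranspose
  exact ⟨p, A.opTranspose, colExact_opTranspose_iff.2 hA⟩

lemma ColSyz.unop {k : ℕ} : ∀ {q p : ℕ} {A : Matrix (Fin q) (Fin p) Rᵐᵒᵖ}, ColSyz k A →
    RowSyz k A.unopTranspose := by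
  induction k with
  | zero => intros; trivial
  | succ k ih =>
    rintro q p A ⟨r, B, hB, hBA⟩
    exact ⟨r, B.unopTranspose, ih hB, colExact_opTranspose_iff.1 hBA⟩

lemma RowDual.op {n : ℕ} (h : RowDual R n) : ColDual Rᵐᵒᵖ n := by
  intro r q p B A hB hBA
  exact rowExact_opTranspose_iff.2 (h A.unopTranspose B.unopTranspose hB.unop
    (colExact_opTranspose_iff.1 hBA))

end Opposite

/-! ### Flatness as a matrix condition -/

section Flat

variable {R : Type u} [Ring R] {M : Type u} [AddCommGroup M] [Module Rᵐᵒᵖ M]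

/-- The class of `m ⊗ x` in the balanced tensor product. -/
def BalancedTensor.tmul {L : Type u} [AddCommGroup L] [Module R L] (m : M) (x : L) :
    BalancedTensor R M L := QuotientAddGroup.mk (m ⊗ₜ[ℤ] x)

namespace BalancedTensor

variable {L : Type u} [AddCommGroup L] [Module R L]

lemma tmul_add (m : M) (x y : L) : tmul (R := R) m (x + y) = tmul m x + tmul m y := by
  simp [tmul, TensorProduct.tmul_add]

lemma add_tmul (m m' : M) (x : L) : tmul (R := R) (m + m') x = tmul m x + tmul m' x := by
  simp [tmul, TensorProduct.add_tmul]

lemma smul_tmul (m : M) (r : R) (x : L) : tmul (R := R) (MulOpposite.op r • m) x = tmul m (r • x) :=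
  (QuotientAddGroup.eq_iff_sub_mem).2 (AddSubgroup.subset_closure ⟨m, r, x, rfl⟩)

lemma tmul_zero (m : M) : tmul (R := R) m (0 : L) = 0 := by
  simp [tmul]

lemma tmul_sum (m : M) {ι : Type*} (s : Finset ι) (x : ι → L) :
    tmul (R := R) m (∑ i ∈ s, x i) = ∑ i ∈ s, tmul m (x i) :=
  map_sum (AddMonoidHom.mk' (fun x : L => tmul (R := R) m x) (tmul_add m)) x s

lemma sum_tmul {ι : Type*} (s : Finset ι) (m : ι → M) (x : L) :
    tmul (R := R) (∑ i ∈ s, m i) x = ∑ i ∈ s, tmul (m i) x :=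
  map_sum (AddMonoidHom.mk' (fun m : M => tmul (R := R) m x) (fun m m' => add_tmul m m' x)) m s

lemma map_tmul {L' : Type u} [AddCommGroup L'] [Module R L'] (f : L →ₗ[R] L') (m : M) (x : L) :
    map M f (tmul m x) = tmul m (f x) := rfl

lemma exists_sum_tmul (t : BalancedTensor R M L) :
    ∃ (n : ℕ) (m : Fin n → M) (x : Fin n → L), t = ∑ i, tmul (m i) (x i) := by
  obtain ⟨t, rfl⟩ := QuotientAddGroup.mk_surjective t
  induction t using TensorProduct.induction_on with
  | zero => exact ⟨0, Fin.elim0, Fin.elim0, by simp⟩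
  | tmul m x => exact ⟨1, fun _ => m, fun _ => x, by simp [tmul]⟩
  | add s t hs ht =>
    obtain ⟨a, m, x, h⟩ := hs
    obtain ⟨b, m', x', h'⟩ := ht
    refine ⟨a + b, Fin.append m m', Fin.append x x', ?_⟩
    rw [Fin.sum_univ_add]
    simp [← h, ← h']

/-- The homomorphism out of the balanced tensor product given by a balanced biadditive map. -/
def lift {G : Type*} [AddCommGroup G] (φ : M →+ L →+ G)
    (h : ∀ (m : M) (r : R) (x : L), φ (MulOpposite.op r • m) x = φ m (r • x)) : BalancedTensor R M L →+ G :=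
  QuotientAddGroup.lift _ (TensorProduct.liftAddHom φ (fun n m x => by simp)) (by
    refine (AddSubgroup.closure_le _).2 ?_
    rintro _ ⟨m, r, x, rfl⟩
    simp [AddMonoidHom.mem_ker, h])

end BalancedTensor

open BalancedTensor

/-- Flatness is applied to the inclusion of the image `L` of the transposed `B` into `R^r`. The
equations `B e = 0` say that the tensor built from `e` dies in `M ⊗ R^r`, so it is already zero in
`M ⊗ L`. The map `φ` from `M ⊗ L` to `M^q` modulo the image of `A` then reads off the class of `e`.
-/
lemma IsFlatRight.torExact (h : IsFlatRight (ModuleCat.of Rᵐᵒᵖ M)) : TorExact Rᵐᵒᵖ 0 M := by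
  classical
  intro r q p B A _ hBA e he
  let f : (Fin q → R) →ₗ[R] (Fin r → R) := B.unopTranspose.vecMulLinear
  have hker : ∀ x, x ∈ LinearMap.ker f → ∃ y, Matrix.vecMul y A.unopTranspose = x :=
    fun x hx => ((colExact_opTranspose_iff (B := A.unopTranspose) (A := B.unopTranspose)).1 hBA x).1
      hx
  let L := (Fin q → R) ⧸ LinearMap.ker f
  let i : L →ₗ[R] (Fin r → R) := (LinearMap.ker f).liftQ f le_rfl
  have hi : Function.Injective i := LinearMap.ker_eq_bot.1 (Submodule.ker_liftQ_eq_bot _ _ _ le_rfl)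
  let φ₀ : M →+ (Fin q → R) →+ (Fin q → M) := AddMonoidHom.mk' (fun m => AddMonoidHom.mk'
    (fun x j => MulOpposite.op (x j) • m) (fun x y => by ext j; simp [add_smul]))
    (fun m m' => by ext x j; simp)
  have hφ₀ : ∀ m x j, φ₀ m x j = MulOpposite.op (x j) • m := fun _ _ _ => rfl
  let G := (Fin q → M) ⧸ (colAct M A).range
  let π : (Fin q → M) →+ G := QuotientAddGroup.mk' _
  let φ₁ : M → L →+ G := fun m => QuotientAddGroup.lift (LinearMap.ker f).toAddSubgroup
    (π.comp (φ₀ m)) (by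
      intro x hx
      obtain ⟨y, rfl⟩ := hker x hx
      refine (QuotientAddGroup.eq_zero_iff _).2 ⟨fun l => MulOpposite.op (y l) • m, ?_⟩
      ext j
      simp [colAct_apply, hφ₀, Matrix.vecMul, dotProduct, Finset.sum_smul, Matrix.unopTranspose,
        mul_smul])
  have hφ₁ : ∀ m (x : Fin q → R), φ₁ m (Submodule.Quotient.mk x) = π (φ₀ m x) := fun _ _ => rfl
  let φ : M →+ L →+ G := AddMonoidHom.mk' φ₁ (fun m m' => by
    ext x
    obtain ⟨x, rfl⟩ := Submodule.Quotient.mk_surjective _ x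
    change φ₁ _ _ = φ₁ _ _ + φ₁ _ _
    simp only [hφ₁, map_add, AddMonoidHom.add_apply])
  have hφ : ∀ (m : M) (s : R) (x : L), φ (MulOpposite.op s • m) x = φ m (s • x) := by
    intro m s x
    obtain ⟨x, rfl⟩ := Submodule.Quotient.mk_surjective _ x
    change φ₁ _ _ = φ₁ _ (Submodule.Quotient.mk (s • x))
    rw [hφ₁, hφ₁]
    congr 1
    ext j
    simp [hφ₀, mul_smul]
  have hzero : (∑ j, tmul (R := R) (e j) (Submodule.Quotient.mk (Pi.single j 1) : L)) = 0 := by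
    refine h (ModuleCat.of R L) (ModuleCat.of R (Fin r → R)) i hi ?_
    rw [map_zero, map_sum]
    have h1 : ∀ j, i (Submodule.Quotient.mk (Pi.single j 1)) =
        ∑ l, B.unopTranspose j l • (Pi.single l 1 : Fin r → R) := fun j => by
      ext l
      change Matrix.vecMul (Pi.single j 1) B.unopTranspose l = _
      simp [Finset.sum_apply, Pi.single_apply]
    refine (Finset.sum_congr rfl fun j _ => (map_tmul i (e j) _).trans (by rw [h1, tmul_sum])).trans
      ?_
    rw [Finset.sum_comm]
    refine Finset.sum_eq_zero fun l _ => ?_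
    simp only [← smul_tmul]
    rw [← sum_tmul]
    have h2 : ∑ j, MulOpposite.op (B.unopTranspose j l) • e j = 0 := congrFun he l
    rw [h2]
    exact map_zero (AddMonoidHom.mk' (fun m : M => tmul (R := R) m (Pi.single l 1 : Fin r → R))
      (fun m m' => add_tmul m m' _))
  have h3 := congrArg (lift φ hφ) hzero
  rw [map_zero, map_sum] at h3
  have h4 : ∑ j, π (φ₀ (e j) (Pi.single j 1)) = 0 := h3
  rw [← map_sum] at h4
  obtain ⟨w, hw⟩ := (QuotientAddGroup.eq_zero_iff _).1 h4
  refine ⟨w, hw.trans ?_⟩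
  ext j
  rw [Finset.sum_apply, Finset.sum_eq_single j]
  · simp [hφ₀]
  · intro l _ hl
    simp [hφ₀, Pi.single_eq_of_ne hl.symm]
  · simp

/-- The equational criterion for flatness. Only the coordinates in the finite union `T` of supports
matter, so the relations form a finite matrix `B`. -/
lemma TorExact.equational (hC : ColCoherent Rᵐᵒᵖ) (h : TorExact Rᵐᵒᵖ 0 M) {m : ℕ} {ι : Type*}
    (k : Fin m → (ι →₀ R)) (v : Fin m → M) (hv : ∀ a, ∑ c, MulOpposite.op (k c a) • v c = 0) :
    ∃ (p : ℕ) (A : Fin m → Fin p → R) (w : Fin p → M),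
      (∀ c, v c = ∑ l, MulOpposite.op (A c l) • w l) ∧ ∀ l, ∑ c, A c l • k c = 0 := by
  classical
  let T : Finset ι := Finset.univ.biUnion fun c => (k c).support
  let B : Matrix (Fin T.card) (Fin m) Rᵐᵒᵖ :=
    Matrix.of fun a c => MulOpposite.op (k c (T.equivFin.symm a))
  obtain ⟨p, A, hBA⟩ := hC B
  obtain ⟨w, hw⟩ := h B A trivial hBA v (by
    ext a
    exact hv _)
  refine ⟨p, fun c l => MulOpposite.unop (A c l), w, fun c => (congrFun hw c).symm, fun l => ?_⟩
  ext a
  rw [Finsupp.finsetSum_apply]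
  by_cases ha : a ∈ T
  · have h1 := congrFun (congrFun hBA.mul_eq_zero (T.equivFin ⟨a, ha⟩)) l
    simpa [Matrix.mul_apply, B] using congrArg MulOpposite.unop h1
  · refine Finset.sum_eq_zero fun c _ => ?_
    have : k c a = 0 := by
      by_contra hne
      exact ha (Finset.mem_biUnion.2 ⟨c, Finset.mem_univ _, Finsupp.mem_support_iff.2 hne⟩)
    simp [this]

/-- The product of an element of a right module and a finitely supported function. -/
noncomputable def finsuppTmul {ι : Type*} (m : M) (k : ι →₀ R) : ι →₀ M :=
  k.mapRange (fun r => MulOpposite.op r • m) (by simp)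

lemma finsuppTmul_apply {ι : Type*} (m : M) (k : ι →₀ R) (a : ι) :
    finsuppTmul m k a = MulOpposite.op (k a) • m := rfl

lemma exists_sum_of_mem_closure {ι : Type*} {P : (ι →₀ R) → Prop} (hP : ∀ k, P k → P (-k))
    {z : ι →₀ M} (hz : z ∈ AddSubgroup.closure {z | ∃ m k, P k ∧ z = finsuppTmul m k}) :
    ∃ (n : ℕ) (m : Fin n → M) (k : Fin n → (ι →₀ R)), (∀ j, P (k j)) ∧
      z = ∑ j, finsuppTmul (m j) (k j) := by
  induction hz using AddSubgroup.closure_induction with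
  | mem z hz =>
    obtain ⟨m, k, hk, rfl⟩ := hz
    exact ⟨1, fun _ => m, fun _ => k, fun _ => hk, by simp⟩
  | zero => exact ⟨0, Fin.elim0, Fin.elim0, fun j => j.elim0, by simp⟩
  | add z z' _ _ h h' =>
    obtain ⟨n, m, k, hk, rfl⟩ := h
    obtain ⟨n', m', k', hk', rfl⟩ := h'
    refine ⟨n + n', Fin.append m m', Fin.append k k', fun j => ?_, ?_⟩
    · refine Fin.addCases (fun j => ?_) (fun j => ?_) j
      · simpa using hk j
      · simpa using hk' j
    · rw [Fin.sum_univ_add]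
      simp
  | neg z _ h =>
    obtain ⟨n, m, k, hk, rfl⟩ := h
    refine ⟨n, m, fun j => -k j, fun j => hP _ (hk j), ?_⟩
    rw [← Finset.sum_neg_distrib]
    refine Finset.sum_congr rfl fun j _ => ?_
    ext a
    simp [finsuppTmul_apply]

lemma TorExact.isFlatRight (hC : ColCoherent Rᵐᵒᵖ) (h : TorExact Rᵐᵒᵖ 0 M) :
    IsFlatRight (ModuleCat.of Rᵐᵒᵖ M) := by
  classical
  intro L L' f hf
  rw [injective_iff_map_eq_zero]
  intro t ht
  obtain ⟨n, e, x, rfl⟩ := exists_sum_tmul t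
  let ε : (L' →₀ R) →ₗ[R] L' := Finsupp.linearCombination R id
  let K : AddSubgroup (L' →₀ M) :=
    -- The quotient by `K` stands in for `M ⊗ L'`, computed from the free presentation `ε`;
    -- vanishing there is an explicit finite identity in `L' →₀ M`.
    AddSubgroup.closure {z | ∃ m k, ε k = 0 ∧ z = finsuppTmul m k}
  let π : (L' →₀ M) →+ (L' →₀ M) ⧸ K := QuotientAddGroup.mk' K
  have hπ : ∀ (m : M) (k : L' →₀ R), ε k = 0 → π (finsuppTmul m k) = 0 := fun m k hk =>
    (QuotientAddGroup.eq_zero_iff _).2 (AddSubgroup.subset_closure ⟨m, k, hk, rfl⟩)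
  have hadd : ∀ (m : M) (y z : L'), π (Finsupp.single (y + z) m) =
      π (Finsupp.single y m) + π (Finsupp.single z m) := fun m y z => by
    have h1 := hπ m (Finsupp.single (y + z) 1 - Finsupp.single y 1 - Finsupp.single z 1)
      (by simp [ε])
    have h2 : finsuppTmul (R := R) m
        (Finsupp.single (y + z) 1 - Finsupp.single y 1 - Finsupp.single z 1) =
        Finsupp.single (y + z) m - Finsupp.single y m - Finsupp.single z m := by
      ext a
      simp [finsuppTmul_apply, Finsupp.single_apply, sub_smul, apply_ite MulOpposite.op, ite_smul]
    rw [h2, map_sub, map_sub, sub_sub, sub_eq_zero] at h1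
    exact h1
  let φ : M →+ L' →+ (L' →₀ M) ⧸ K := AddMonoidHom.mk' (fun m => AddMonoidHom.mk'
    (fun y => π (Finsupp.single y m)) (hadd m)) (fun m m' => by
      ext y
      simp [Finsupp.single_add])
  have hφ : ∀ (m : M) (s : R) (y : L'), φ (MulOpposite.op s • m) y = φ m (s • y) := by
    intro m s y
    have h1 := hπ m (Finsupp.single y s - Finsupp.single (s • y) 1) (by simp [ε])
    have h2 : finsuppTmul m (Finsupp.single y s - Finsupp.single (s • y) 1) =
        Finsupp.single y (MulOpposite.op s • m) - Finsupp.single (s • y) m := by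
      ext a
      simp [finsuppTmul_apply, Finsupp.single_apply, sub_smul, apply_ite MulOpposite.op, ite_smul]
    rw [h2, map_sub, sub_eq_zero] at h1
    exact h1
  have h3 := congrArg (lift φ hφ) ht
  rw [map_zero, map_sum, map_sum] at h3
  have h4 : ∑ j, π (Finsupp.single (f (x j)) (e j)) = 0 := h3
  rw [← map_sum] at h4
  obtain ⟨s, m, k, hk, hsum⟩ := exists_sum_of_mem_closure (P := fun k => ε k = 0)
    (fun k hk => by rw [map_neg, hk, neg_zero]) ((QuotientAddGroup.eq_zero_iff _).1 h4)
  obtain ⟨p, A, w, hw, hA⟩ := h.equational hC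
    (Fin.append (fun j => Finsupp.single (f (x j)) 1) k) (Fin.append e (-m)) (by
      intro a
      have h5 := DFunLike.congr_fun hsum a
      rw [Finsupp.finsetSum_apply, Finsupp.finsetSum_apply] at h5
      rw [Fin.sum_univ_add]
      simp only [Fin.append_left, Fin.append_right, Pi.neg_apply, smul_neg,
        Finset.sum_neg_distrib]
      rw [add_neg_eq_zero]
      refine Eq.trans (Finset.sum_congr rfl fun j _ => ?_) h5
      simp [Finsupp.single_apply, apply_ite MulOpposite.op, ite_smul])
  -- Applying `ε` kills the relations `k`, leaving an equation between the `f (x j)`, and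
  -- injectivity of `f` removes `f`.
  have h6 : ∀ l, ∑ j, A (Fin.castAdd s j) l • x j = 0 := fun l => by
    refine hf ?_
    have h7 := congrArg ε (hA l)
    rw [map_zero, map_sum, Fin.sum_univ_add] at h7
    simpa [hk, ε] using h7
  have h8 : ∀ j, e j = ∑ l, MulOpposite.op (A (Fin.castAdd s j) l) • w l := fun j => by
    simpa using hw (Fin.castAdd s j)
  calc ∑ j, tmul (R := R) (e j) (x j)
      = ∑ j, ∑ l, tmul (w l) (A (Fin.castAdd s j) l • x j) := by
        refine Finset.sum_congr rfl fun j _ => ?_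
        rw [h8, sum_tmul]
        exact Finset.sum_congr rfl fun l _ => smul_tmul _ _ _
    _ = 0 := by
        rw [Finset.sum_comm]
        refine Finset.sum_eq_zero fun l _ => ?_
        rw [← tmul_sum, h6, tmul_zero]

end Flat

/-! ### Finite flat dimension -/

section FlatDimension

variable {R : Type u} [Ring R]

/-- Flat modules satisfy the bound `n` by duality, and passing to the cokernel of a monomorphism
does not worsen it, so `n` does not depend on the length `k`. -/
lemma HasFlatResolution.syzExact {n : ℕ} (hR : RowCoherent Rᵐᵒᵖ) (hD : RowDual Rᵐᵒᵖ n) (k : ℕ) :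
    ∀ M : ModuleCat.{u} Rᵐᵒᵖ, HasFlatResolution k M → SyzExact Rᵐᵒᵖ n M := by
  induction k with
  | zero =>
    intro M hM
    exact (IsFlatRight.torExact (M := M) hM).syzExact hD
  | succ k ih =>
    rintro M ⟨T, hT, ⟨e⟩, hflat, h⟩
    have h2 : SyzExact Rᵐᵒᵖ n T.X₂ := (IsFlatRight.torExact (M := T.X₂) hflat).syzExact hD
    have h3 : SyzExact Rᵐᵒᵖ n T.X₃ := SyzExact.quotient hR hT.moduleCat_injective_f
      ((ShortComplex.ShortExact.moduleCat_exact_iff_function_exact T).1 hT.exact)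
      hT.moduleCat_surjective_g (ih T.X₁ h).succ h2
    exact h3.of_linearEquiv e.toLinearEquiv

lemma TorExact.hasFlatResolution (hC : ColCoherent Rᵐᵒᵖ) (k : ℕ) :
    ∀ M : ModuleCat.{u} Rᵐᵒᵖ, TorExact Rᵐᵒᵖ k M → HasFlatResolution k M := by
  induction k with
  | zero =>
    intro M hM
    exact TorExact.isFlatRight (M := M) hC hM
  | succ k ih =>
    intro M hM
    let π : (M →₀ Rᵐᵒᵖ) →ₗ[Rᵐᵒᵖ] M := Finsupp.linearCombination Rᵐᵒᵖ id
    have hπ : Function.Surjective π := Finsupp.linearCombination_id_surjective _ _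
    have hF : TorExact Rᵐᵒᵖ 0 (M →₀ Rᵐᵒᵖ) := torExact_zero_finsupp Rᵐᵒᵖ M
    exact ⟨π.shortComplexKer, LinearMap.shortExact_shortComplexKer hπ, ⟨Iso.refl _⟩,
      hF.isFlatRight hC, ih _ (TorExact.syzygy hC (LinearMap.ker π).injective_subtype
        (LinearMap.exact_subtype_ker_map π) hπ hF hM)⟩

lemma flatDimension_lt_top_iff (M : ModuleCat.{u} Rᵐᵒᵖ) :
    flatDimension M < ⊤ ↔ ∃ k, HasFlatResolution k M := by
  simp only [flatDimension, iInf_lt_iff]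
  exact ⟨fun ⟨k, h, _⟩ => ⟨k, h⟩, fun ⟨k, h⟩ => ⟨k, h, ENat.natCast_lt_top k⟩⟩

end FlatDimension

/-! ### Two-sided sequences and acyclicity -/

section Complexes

lemma exists_int_seq {α : Type*} (P : α → Prop) (rel : α → α → Prop)
    (hr : ∀ a, P a → ∃ b, P b ∧ rel a b) (hl : ∀ b, P b → ∃ a, P a ∧ rel a b) (a : α) (ha : P a) :
    ∃ Z : ℤ → α, Z 0 = a ∧ (∀ i, P (Z i)) ∧ ∀ i, rel (Z i) (Z (i + 1)) := by
  choose f hf using fun a : {a // P a} => hr a.1 a.2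
  choose g hg using fun a : {a // P a} => hl a.1 a.2
  let F : {a // P a} → {a // P a} := fun a => ⟨f a, (hf a).1⟩
  let G : {a // P a} → {a // P a} := fun a => ⟨g a, (hg a).1⟩
  let Z : ℤ → {a // P a}
    | Int.ofNat k => F^[k] ⟨a, ha⟩
    | Int.negSucc k => G^[k + 1] ⟨a, ha⟩
  refine ⟨fun i => (Z i).1, rfl, fun i => (Z i).2, ?_⟩
  rintro (k | k)
  · change rel (F^[k] ⟨a, ha⟩).1 (F^[k + 1] ⟨a, ha⟩).1
    rw [Function.iterate_succ_apply']
    exact (hf _).2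
  · have h : Z (Int.negSucc k + 1) = G^[k] ⟨a, ha⟩ := by
      cases k <;> rfl
    change rel (G^[k + 1] ⟨a, ha⟩).1 (Z (Int.negSucc k + 1)).1
    rw [h, Function.iterate_succ_apply']
    exact (hg _).2

variable {C : Type*} [Category* C] [Preadditive C]

lemma CochainComplex.acyclic_iff (K : CochainComplex C ℤ) :
    K.Acyclic ↔ ∀ i : ℤ, (K.sc' i (i + 1) (i + 1 + 1)).Exact := by
  have key : ∀ i : ℤ, K.ExactAt (i + 1) ↔ (K.sc' i (i + 1) (i + 1 + 1)).Exact := fun i =>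
    K.exactAt_iff' i (i + 1) (i + 1 + 1) (by simp) (by simp)
  constructor
  · intro h i
    exact (key i).1 (h _)
  · intro h i
    obtain ⟨j, rfl⟩ : ∃ j, i = j + 1 := ⟨i - 1, by lia⟩
    exact (key j).2 (h j)

lemma acyclic_coyoneda_iff (K : CochainComplex C ℤ) (E : C) :
    (((preadditiveCoyoneda.obj (op E)).mapHomologicalComplex (ComplexShape.up ℤ)).obj K).Acyclic ↔
      ∀ (i : ℤ) (φ : E ⟶ K.X (i + 1)), φ ≫ K.d (i + 1) (i + 1 + 1) = 0 →
        ∃ ψ : E ⟶ K.X i, ψ ≫ K.d i (i + 1) = φ := by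
  rw [CochainComplex.acyclic_iff]
  exact forall_congr' fun i => ShortComplex.ab_exact_iff _

end Complexes

/-! ### Ding injective modules and the orthogonal class -/

section DingInjective

open Abelian Limits

variable {S : Type u} [Ring S] {n : ℕ}

lemma injective_syzExact (hR : RowCoherent S) (k : ℕ) (I : ModuleCat.{u} S) [Injective I] :
    SyzExact S k I :=
  (subsingleton_ext_iff_syzExact hR k I).1 fun F _ => Ext.subsingleton_of_injective F I k

lemma exists_shortExact_injective (hR : RowCoherent S) (W : ModuleCat.{u} S) :
    ∃ T : ShortComplex (ModuleCat.{u} S), T.ShortExact ∧ T.X₁ = W ∧ Injective T.X₂ ∧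
      ∀ k, SyzExact S (k + 1) W → SyzExact S k T.X₃ := by
  let T := ShortComplex.mk (Injective.ι W) (cokernel.π (Injective.ι W)) (cokernel.condition _)
  have hT : T.ShortExact := { exact := ShortComplex.exact_cokernel _ }
  have : Injective T.X₂ := inferInstanceAs (Injective (Injective.under W))
  refine ⟨T, hT, rfl, this, fun k hW => ?_⟩
  exact SyzExact.quotient hR hT.moduleCat_injective_f
    ((ShortComplex.ShortExact.moduleCat_exact_iff_function_exact T).1 hT.exact)
    hT.moduleCat_surjective_g hW (injective_syzExact hR k T.X₂)

theorem IsDingInjective.subsingleton_ext (hR : RowCoherent S) {N : ModuleCat.{u} S}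
    (hN : IsDingInjective N) (k : ℕ) (W : ModuleCat.{u} S) (hW : SyzExact S k W) :
    Subsingleton (Ext W N 1) := by
  obtain ⟨I, hI, hex, ⟨e⟩, hHom⟩ := hN
  rw [CochainComplex.acyclic_iff] at hex
  let Z : ℤ → ModuleCat.{u} S := fun i => ModuleCat.of S (LinearMap.ker (I.d i (i + 1)).hom)
  have hex' : ∀ i, ∃ T : ShortComplex (ModuleCat.{u} S), T.ShortExact ∧ T.X₁ = Z i ∧
      Injective T.X₂ ∧ T.X₃ = Z (i + 1) ∧ ∀ E : ModuleCat.{u} S, IsFPInjective E →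
        ∀ φ : E ⟶ T.X₃, ∃ ψ : E ⟶ T.X₂, ψ ≫ T.g = φ := by
    intro i
    have hdd : ∀ x, (I.d (i + 1) (i + 1 + 1)).hom ((I.d i (i + 1)).hom x) = 0 := fun x =>
      LinearMap.congr_fun (congrArg ModuleCat.Hom.hom (I.d_comp_d i (i + 1) (i + 1 + 1))) x
    let g : I.X i →ₗ[S] LinearMap.ker (I.d (i + 1) (i + 1 + 1)).hom :=
      (I.d i (i + 1)).hom.codRestrict _ hdd
    have hg : ∀ x, (g x : I.X (i + 1)) = (I.d i (i + 1)).hom x := fun _ => rfl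
    refine ⟨ModuleCat.shortComplexOfCompEqZero (LinearMap.ker (I.d i (i + 1)).hom).subtype g ?_,
      ModuleCat.shortComplex_shortExact _ ?_ Subtype.val_injective ?_, rfl, hI i, rfl, ?_⟩
    · ext x
      exact x.2
    · intro x
      constructor
      · intro hx
        exact ⟨⟨x, congrArg Subtype.val hx⟩, rfl⟩
      · rintro ⟨y, rfl⟩
        exact Subtype.ext y.2
    · rintro ⟨y, hy⟩
      obtain ⟨x, hx⟩ := (ShortComplex.moduleCat_exact_iff _).1 (hex i) y hy
      exact ⟨x, Subtype.ext hx⟩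
    · intro E hE φ
      let ι : ModuleCat.of S (LinearMap.ker (I.d (i + 1) (i + 1 + 1)).hom) ⟶ I.X (i + 1) :=
        ModuleCat.ofHom (LinearMap.ker (I.d (i + 1) (i + 1 + 1)).hom).subtype
      have hφ : (φ ≫ ι) ≫ I.d (i + 1) (i + 1 + 1) = 0 :=
        ModuleCat.hom_ext (LinearMap.ext fun x => (φ.hom x).2)
      obtain ⟨ψ, hψ⟩ := (acyclic_coyoneda_iff I E).1 (hHom E hE) i (φ ≫ ι) hφ
      refine ⟨ψ, ModuleCat.hom_ext (LinearMap.ext fun x => Subtype.ext ?_)⟩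
      exact LinearMap.congr_fun (congrArg ModuleCat.Hom.hom hψ) x
  have hfp : ∀ (i : ℤ) (E : ModuleCat.{u} S), IsFPInjective E → Subsingleton (Ext E (Z i) 1) := by
    intro i E hE
    obtain ⟨T, hT, h1, _, _, hlift⟩ := hex' i
    rw [← h1]
    exact hT.subsingleton_ext_of_lift (hlift E hE)
  have key : ∀ (k : ℕ) (W : ModuleCat.{u} S), SyzExact S k W → ∀ i, Subsingleton (Ext W (Z i) 1) := by
    intro k
    induction k with
    | zero =>
      intro W hW i
      exact hfp i W ((isFPInjective_iff_syzExact hR W).2 hW)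
    | succ k ih =>
      intro W hW i
      obtain ⟨T, hT, h1, hinj, hlift⟩ : ∃ T : ShortComplex (ModuleCat.{u} S), T.ShortExact ∧
          T.X₁ = W ∧ Injective T.X₂ ∧ SyzExact S k T.X₃ := by
        obtain ⟨T, hT, h1, h2, h3⟩ := exists_shortExact_injective hR W
        exact ⟨T, hT, h1, h2, h3 k hW⟩
      subst h1
      obtain ⟨T', hT', h1', _, h3', _⟩ := hex' i
      rw [← h1']
      refine hT'.subsingleton_ext_of_lift fun φ => ?_
      -- A map to the next cycle extends to the injective hull `T.X₂` by induction. That module is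
      -- FP-injective, so the extension lifts to the complex; restricting to `W` gives the required
      -- lift.
      obtain ⟨φ', rfl⟩ := hT.exists_extension (h3' ▸ ih T.X₃ hlift (i + 1)) φ
      obtain ⟨ψ, rfl⟩ := hT'.exists_lift (h1' ▸ hfp i T.X₂ ((isFPInjective_iff_syzExact hR T.X₂).2
        (injective_syzExact hR 0 T.X₂))) φ'
      exact ⟨T.f ≫ ψ, Category.assoc _ _ _⟩
  exact subsingleton_ext_of_iso_right (e ≪≫ ModuleCat.kernelIsoKer (I.d 0 1)).symm (key k W hW 0)

variable (n) in
/-- `N` is right orthogonal to the modules that are `SyzExact` at position `n`. -/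
def IsSyzOrthogonal (N : ModuleCat.{u} S) : Prop :=
  ∀ W : ModuleCat.{u} S, SyzExact S n W → Subsingleton (Ext W N 1)

lemma exists_projective_cover (W : ModuleCat.{u} S) :
    ∃ T : ShortComplex (ModuleCat.{u} S), T.ShortExact ∧ T.X₃ = W ∧ Projective T.X₂ ∧
      ∃ ι : Type u, Nonempty (T.X₂ ≅ ModuleCat.of S (ι →₀ S)) := by
  let π : (W →₀ S) →ₗ[S] W := Finsupp.linearCombination S id
  exact ⟨π.shortComplexKer, LinearMap.shortExact_shortComplexKer
    (Finsupp.linearCombination_id_surjective _ _), rfl,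
    (IsProjective.iff_projective _).1 (inferInstanceAs (Module.Projective S (W →₀ S))), W,
    ⟨Iso.refl _⟩⟩

lemma ExtendsSmall.isSyzOrthogonal {N : ModuleCat.{u} S} (hN : ExtendsSmall S n N) :
    IsSyzOrthogonal n N := by
  intro W hW
  obtain ⟨P, π, hP, hπ⟩ : ∃ (P : ModuleCat.{u} S) (π : P →ₗ[S] W), Projective P ∧
      Function.Surjective π := by
    obtain ⟨T, hT, rfl, hP, _⟩ := exists_projective_cover W
    exact ⟨T.X₂, T.g.hom, hP, hT.moduleCat_surjective_g⟩
  have : Projective π.shortComplexKer.X₂ := hP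
  refine (LinearMap.shortExact_shortComplexKer hπ).subsingleton_ext_of_extension fun φ => ?_
  obtain ⟨ψ, hψ⟩ := hN.extend (LinearMap.ker π)
    (hW.of_linearEquiv (π.quotKerEquivOfSurjective hπ).symm) φ.hom
  exact ⟨ModuleCat.ofHom ψ, ModuleCat.hom_ext hψ⟩

/-- The ring `S` is `n`-Gorenstein in the sense needed for the cotorsion pair: `S` is `SyzExact` at
position `n`, and finite FP-injective dimension is bounded by `n`. -/
structure SyzGorenstein (S : Type u) [Ring S] (n : ℕ) : Prop where
  rowCoherent : RowCoherent S
  syzExact_self : SyzExact S n S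
  syzExact_of_succ : ∀ (E : ModuleCat.{u} S), SyzExact S (n + 1) E → SyzExact S n E

/-- The first syzygy of a trivial module is trivial, as its possible dimension `n + 1` drops back to
`n`. A map from it to `T.X₃` therefore lifts to the injective `T.X₂`, where it extends to the free
module. -/
lemma IsSyzOrthogonal.cosyzygy (hS : SyzGorenstein S n) {T : ShortComplex (ModuleCat.{u} S)}
    (hT : T.ShortExact) [Injective T.X₂] (h : IsSyzOrthogonal n T.X₁) : IsSyzOrthogonal n T.X₃ := by
  intro W hW
  obtain ⟨T', hT', rfl, hP, ι, ⟨e⟩⟩ := exists_projective_cover W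
  refine hT'.subsingleton_ext_of_extension fun φ => ?_
  have h2 : SyzExact S n T'.X₂ :=
    (hS.syzExact_self.finsupp ι).of_linearEquiv e.symm.toLinearEquiv
  have h1 : SyzExact S n T'.X₁ := hS.syzExact_of_succ _ (by
    have hex := (ShortComplex.ShortExact.moduleCat_exact_iff_function_exact T').1 hT'.exact
    exact SyzExact.kernel_succ hT'.moduleCat_injective_f hex hT'.moduleCat_surjective_g h2 hW)
  obtain ⟨ψ, rfl⟩ := hT.exists_lift (h T'.X₁ h1) φ
  have := hT'.mono_f
  exact ⟨Injective.factorThru ψ T'.f ≫ T.g, by rw [← Category.assoc, Injective.comp_factorThru]⟩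

lemma IsSyzOrthogonal.exists_injective_cover (hS : SyzGorenstein S n) {N : ModuleCat.{u} S}
    (h : IsSyzOrthogonal n N) : ∃ T : ShortComplex (ModuleCat.{u} S), T.ShortExact ∧ T.X₃ = N ∧
      Injective T.X₂ ∧ IsSyzOrthogonal n T.X₁ := by
  obtain ⟨W, g, hW, hg, hK⟩ := exists_syzExact_cover hS.syzExact_self N
  have hT := LinearMap.shortExact_shortComplexKer (f := g.hom) hg
  have hK' : IsSyzOrthogonal n (ModuleCat.of S (LinearMap.ker g.hom)) :=
    ExtendsSmall.isSyzOrthogonal hK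
  refine ⟨_, hT, rfl, ?_, hK'⟩
  have hWo : IsSyzOrthogonal n W := fun V hV =>
    hT.subsingleton_ext_extension (hK' V hV) (h V hV)
  obtain ⟨T', hT', rfl, hinj, hC⟩ := exists_shortExact_injective hS.rowCoherent W
  -- The cokernel of the embedding of the trivial module into an injective one is trivial, so
  -- orthogonality splits the embedding.
  obtain ⟨r, hr⟩ := hT'.exists_extension (hWo _ (hC n hW.succ)) (𝟙 _)
  exact Retract.injective ⟨T'.f, r, hr⟩

theorem IsSyzOrthogonal.isDingInjective (hS : SyzGorenstein S n) {N : ModuleCat.{u} S}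
    (hN : IsSyzOrthogonal n N) : IsDingInjective N := by
  obtain ⟨Z, rfl, hZ, hrel⟩ := exists_int_seq (IsSyzOrthogonal (S := S) n)
    (fun a b => ∃ (X : ModuleCat.{u} S) (f : a ⟶ X) (g : X ⟶ b) (w : f ≫ g = 0),
      (ShortComplex.mk f g w).ShortExact ∧ Injective X)
    (fun a ha => by
      obtain ⟨T, hT, rfl, hinj, _⟩ := exists_shortExact_injective hS.rowCoherent a
      exact ⟨T.X₃, ha.cosyzygy hS hT, T.X₂, T.f, T.g, T.zero, hT, hinj⟩)
    (fun b hb => by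
      obtain ⟨T, hT, rfl, hinj, h⟩ := hb.exists_injective_cover hS
      exact ⟨T.X₁, h, T.X₂, T.f, T.g, T.zero, hT, hinj⟩) N hN
  choose X f g w hse hinj using hrel
  have hf : ∀ i, Mono (f i) := fun i => (hse i).mono_f
  have hd : ∀ i, (g i ≫ f (i + 1)) ≫ (g (i + 1) ≫ f (i + 1 + 1)) = 0 := fun i => by
    rw [Category.assoc, ← Category.assoc (f (i + 1)), w, zero_comp, comp_zero]
  let I : CochainComplex (ModuleCat.{u} S) ℤ := CochainComplex.of X (fun i => g i ≫ f (i + 1)) hd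
  have hId : ∀ i, I.d i (i + 1) = g i ≫ f (i + 1) := fun i => CochainComplex.of_d X (fun i => g i ≫ f (i + 1)) i
  have hIx : ∀ i (x : X i), (I.d i (i + 1)).hom x = (f (i + 1)).hom ((g i).hom x) := fun i x => by
    rw [hId]
    rfl
  have hker : ∀ (i : ℤ) (E : ModuleCat.{u} S) (φ : E ⟶ X (i + 1)),
      φ ≫ I.d (i + 1) (i + 1 + 1) = 0 → ∃ ψ : E ⟶ Z (i + 1), ψ ≫ f (i + 1) = φ := by
    intro i E φ hφ
    rw [hId, ← Category.assoc] at hφ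
    exact ⟨(hse (i + 1)).exact.lift φ (zero_of_comp_mono _ hφ), (hse (i + 1)).exact.lift_f _ _⟩
  refine ⟨I, hinj, ?_, ?_, ?_⟩
  · rw [CochainComplex.acyclic_iff]
    intro i
    rw [ShortComplex.moduleCat_exact_iff]
    intro x hx
    have h1 : (g (i + 1)).hom x = 0 :=
      (hse (i + 1 + 1)).moduleCat_injective_f ((hIx (i + 1) x).symm.trans
        (Eq.trans hx (map_zero _).symm))
    obtain ⟨y, rfl⟩ := (ShortComplex.moduleCat_exact_iff _).1 (hse (i + 1)).exact x h1
    obtain ⟨z, rfl⟩ := (hse i).moduleCat_surjective_g y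
    exact ⟨z, hIx i z⟩
  · have e : Z 0 ≅ kernel (g 0) :=
      (hse 0).fIsKernel.conePointUniqueUpToIso (limit.isLimit _)
    exact ⟨e ≪≫ (kernelCompMono (g 0) (f (0 + 1))).symm ≪≫ kernelIsoOfEq (hId 0).symm⟩
  · intro E hE
    rw [acyclic_coyoneda_iff]
    intro i φ hφ
    obtain ⟨ψ, rfl⟩ := hker i E φ hφ
    have hE' : SyzExact S n E :=
      ((isFPInjective_iff_syzExact hS.rowCoherent E).1 hE).mono (Nat.zero_le n)
    -- Exactness under `Hom(E, -)` holds because FP-injective modules are trivial and every cycle is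
    -- orthogonal to them.
    obtain ⟨χ, rfl⟩ := (hse i).exists_lift (hZ i E hE') ψ
    exact ⟨χ, by rw [hId, Category.assoc]⟩

end DingInjective

/-! ### The theorem for Ding–Chen rings -/

theorem mainTheorem4 (R : Type u) [Ring R] (hR : IsDingChenRing R) :
    (∀ W : ModuleCat.{u} Rᵐᵒᵖ, fpInjectiveDimension W < ⊤ ↔ flatDimension W < ⊤) ∧
    ∀ N : ModuleCat.{u} Rᵐᵒᵖ, IsDingInjective N ↔
      ∀ W : ModuleCat.{u} Rᵐᵒᵖ, fpInjectiveDimension W < ⊤ →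
        Subsingleton (Abelian.Ext W N 1) := by
  obtain ⟨n, hR⟩ := hR
  have hRow : RowCoherent Rᵐᵒᵖ := hR.right_coherent.isLeftCoherentRing_op.rowCoherent
  have hRow' : RowCoherent R := hR.left_coherent.rowCoherent
  have hCol : ColCoherent Rᵐᵒᵖ := hRow'.op
  have hself : SyzExact Rᵐᵒᵖ n Rᵐᵒᵖ :=
    (syzExact_of_fpInjectiveDimension_eq hRow hR.right_dim).of_linearEquiv (opSelfEquiv R)
  have hRD : RowDual Rᵐᵒᵖ n := rowDual_of_syzExact hself
  have hCD : ColDual Rᵐᵒᵖ n :=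
    (rowDual_of_syzExact (syzExact_of_fpInjectiveDimension_eq hRow' hR.left_dim)).op
  have hflat : ∀ (k : ℕ) (W : ModuleCat.{u} Rᵐᵒᵖ), SyzExact Rᵐᵒᵖ k W → HasFlatResolution n W :=
    fun k W hW => TorExact.hasFlatResolution hCol n W (hW.torExact hCol hCD)
  -- The uniform bound comes from the round trip through flat resolutions of length `n`.
  have hbound : ∀ (k : ℕ) (W : ModuleCat.{u} Rᵐᵒᵖ), SyzExact Rᵐᵒᵖ k W → SyzExact Rᵐᵒᵖ n W :=
    fun k W hW => (hflat k W hW).syzExact hRow hRD n W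
  have hS : SyzGorenstein Rᵐᵒᵖ n := ⟨hRow, hself, hbound (n + 1)⟩
  refine ⟨fun W => ?_, fun N => ⟨fun hN W hW => ?_, fun h => ?_⟩⟩
  · rw [fpInjectiveDimension_lt_top_iff hRow, flatDimension_lt_top_iff]
    exact ⟨fun ⟨k, hk⟩ => ⟨n, hflat k W hk⟩, fun ⟨k, hk⟩ => ⟨n, hk.syzExact hRow hRD k W⟩⟩
  · obtain ⟨k, hk⟩ := (fpInjectiveDimension_lt_top_iff hRow W).1 hW
    exact hN.subsingleton_ext hRow k W hk
  · exact IsSyzOrthogonal.isDingInjective hS fun W hW =>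
      h W ((fpInjectiveDimension_lt_top_iff hRow W).2 ⟨n, hW⟩)
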